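/- Identify Boolean functions on $n$ bits with functions $c:\{0,1\}^n\to\{\pm1\}$, with Fourier coefficients $\widehat{c}(S)=2^{-n}\sum_{x\in\{0,1\}^n}c(x)(-1)^{S\cdot x}$ for $S\in\{0,1\}^n$. For integers $n,k$, let $\mathcal{C}_{n,k}$ be the class of $k$-Fourier-sparse functions, that is, those $c:\{0,1\}^n\to\{\pm1\}$ with $\widehat{c}(S)\neq 0$ for at most $k$ different $S$. A uniform quantum example for $c$ is the state $|\psi_c\rangle=\frac{1}{\sqrt{2^n}}\sum_{x\in\{0,1\}^n}|x,c(x)\rangle$. A quantum learner using $T$ uniform quantum examples is a quantum measurement (POVM) on the state space of $T$ examples whose outcome is a hypothesis $h:\{0,1\}^n\to\{\pm1\}$; it exactly learns a class $\mathcal{C}$ with probability $\geq p$ if, for every $c\in\mathcal{C}$, the outcome of the measurement on $|\psi_c\rangle^{\otimes T}$ equals $c$ with probability at least $p$. **Theorem.** There is an absolute constant $K>0$ such that for all integers $n>0$ and $2\leq k\leq 2^n$ there are a non-negative integer $$T\leq K\,k^{3/2}(\log_2 k)^2$$ and a quantum learner that exactly learns $\mathcal{C}_{n,k}$ with probability $\geq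 2/3$ from $T$ uniform quantum examples. -/

import Mathlib

open scoped Matrix ComplexOrder

noncomputable section

namespace QLearn

/-! ### Fourier analysis on the Boolean cube -/

/-- The Boolean cube `{0,1}^n`. -/
abbrev Cube (n : ℕ) : Type := Fin n → ZMod 2

/-- Boolean functions `{0,1}^n → {±1}`; the units of `ℤ` are exactly `1` and `-1`. -/
abbrev BoolFun (n : ℕ) : Type := Cube n → ℤˣ

/-- The character `χ_S(x) = (-1)^{S·x}`. -/
def character {n : ℕ} (S x : Cube n) : ℝ := (-1) ^ (S ⬝ᵥ x).val

/-- The Fourier coefficient of `f` at `S`, the uniform average of `f(x) χ_S(x)`. -/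
def cubeFourierCoeff {n : ℕ} (f : Cube n → ℝ) (S : Cube n) : ℝ :=
  (∑ x : Cube n, f x * character S x) / 2 ^ n

/-- The Fourier support of `f`. -/
def fourierSupport {n : ℕ} (f : Cube n → ℝ) : Set (Cube n) := {S | cubeFourierCoeff f S ≠ 0}

/-- A Boolean function regarded as a real-valued one. -/
def BoolFun.toReal {n : ℕ} (c : BoolFun n) : Cube n → ℝ := fun x => ((c x : ℤ) : ℝ)

/-- The concept class of `k`-Fourier-sparse Boolean functions on `n` bits. -/
def sparseClass (n k : ℕ) : Set (BoolFun n) :=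
  {c | (fourierSupport c.toReal).ncard ≤ k}

/-! ### Quantum examples and quantum learners -/

/-- A measurement (POVM) with outcomes in `α` on the quantum system with state space `ℂ^ι`. -/
structure POVM (ι α : Type) [Fintype ι] [DecidableEq ι] [Fintype α] where
  effect : α → Matrix ι ι ℂ
  posSemidef : ∀ a, (effect a).PosSemidef
  sum_eq_one : ∑ a, effect a = 1

/-- Born rule: the probability `⟨ψ| E_a |ψ⟩` of outcome `a` on the pure state `ψ`. -/
def POVM.prob {ι α : Type} [Fintype ι] [DecidableEq ι] [Fintype α]
    (M : POVM ι α) (ψ : ι → ℂ) (a : α) : ℝ :=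
  (star ψ ⬝ᵥ (M.effect a *ᵥ ψ)).re

/-- The computational basis `|x, b⟩`, with `x ∈ {0,1}^n` and `b ∈ {±1}`, of one example register. -/
abbrev ExampleBasis (n : ℕ) : Type := Cube n × ℤˣ

/-- The uniform quantum example `2^{-n/2} ∑ₓ |x, c(x)⟩`, by its amplitudes. -/
def quantumExample {n : ℕ} (c : BoolFun n) : ExampleBasis n → ℂ :=
  fun p => if p.2 = c p.1 then ((1 / Real.sqrt (2 ^ n) : ℝ) : ℂ) else 0

/-- The state `ψ^{⊗T}`, in the product basis indexed by `ι^T`. -/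
def tensorPower {ι : Type} (ψ : ι → ℂ) (T : ℕ) : (Fin T → ι) → ℂ :=
  fun s => ∏ i, ψ (s i)

/-- A quantum learner using `T` quantum examples: an arbitrary quantum measurement of the joint
state of the `T` examples, whose outcome is the hypothesis. -/
abbrev QuantumLearner (n T : ℕ) : Type := POVM (Fin T → ExampleBasis n) (BoolFun n)

/-- The learner `L` exactly learns the class `C` with probability at least `p` from uniform quantum
examples: for every target concept `c ∈ C`, its hypothesis equals `c` with probability at least
`p`. -/
def QuantumLearner.ExactlyLearns {n T : ℕ} (L : QuantumLearner n T) (C : Set (BoolFun n))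
    (p : ℝ) : Prop :=
  ∀ c ∈ C, p ≤ POVM.prob L (tensorPower (quantumExample c) T) c

end QLearn

end

/-! # Quantum exact learning of Fourier-sparse Boolean functions -/

open scoped Matrix ComplexOrder

namespace QLearn

open Finset

/-! ### Characters, Parseval and the uncertainty principle on the cube. -/

section

variable {n : ℕ}

/-! Each example is measured separately. A fair coin chooses between the computational basis, which
reveals `(x, c x)` at a uniform `x`, and the Fourier basis, which yields `(S, -1)` with overall
probability `ĉ(S)² / 4`. The hypothesis is any `k`-sparse function that agrees with the sampled
values and has its spectrum in the span of the sampled characters. Let `U` be the span of the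
Fourier support of `c`, and `r` its dimension. Two things can go wrong.

The sampled characters may miss part of `U`; then some nonzero functional on `U` kills them all. By
the uncertainty principle each such functional is nonzero on Fourier weight at least `1/k`
(`one_div_le_fourier_weight`), so a union bound over `2^r` functionals needs only `T` of order `k
r`.

Or a wrong sparse `c'` with spectrum in `U` survives the sampled values. If it differs from `c` on a
fraction `d` of the cube, this has probability `(1 - d/2)^T`. The spectral norm of `(c - c')/2` is
at most `√(2kd)`, so Maurey's method encodes `c'` by `O(k d log k)` characters of `U`
(`card_le_of_code_length`). The resulting `2^O(r k d log k)` candidates are beaten at every distance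
by `T` of order `k r log k` (`sum_survival_le`).

It remains to see `r = O(√k log k)` (`BoolFun.finrank_span_fourierSupport_le`). For a restriction of
`c` of sparsity `q`, `O(√q)` parities identify every frequency with another one, apart from one
class (`ConvSqOne.exists_merging`), which removes about `q/2` frequencies. While `L` frequencies
remain, some restriction has `q ≥ L²/k` (`exists_sq_card_image_le`), so the dimension paid is
`O(√k)` times the relative decrease of `L`. These costs telescope to `O(√k log k)`. -/

lemma neg_one_pow_val_add (a b : ZMod 2) :
    ((-1 : ℝ)) ^ (a + b).val = (-1) ^ a.val * (-1) ^ b.val := by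
  rw [ZMod.val_add, ← pow_add]
  rcases Nat.even_or_odd (a.val + b.val) with h | h
  · rw [h.neg_one_pow, Nat.even_iff.mp h, pow_zero]
  · rw [h.neg_one_pow, Nat.odd_iff.mp h, pow_one]

lemma character_add_left (S S' x : Cube n) :
    character (S + S') x = character S x * character S' x := by
  simp only [character, add_dotProduct, neg_one_pow_val_add]

lemma character_comm (S x : Cube n) : character S x = character x S := by
  simp only [character, dotProduct_comm]

lemma character_add_right (S x y : Cube n) :
    character S (x + y) = character S x * character S y := by
  simp only [character, dotProduct_add, neg_one_pow_val_add]

@[simp] lemma character_zero_left (x : Cube n) : character 0 x = 1 := by simp [character]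

lemma character_eq_or (S x : Cube n) : character S x = 1 ∨ character S x = -1 :=
  neg_one_pow_eq_or ℝ _

@[simp] lemma abs_character (S x : Cube n) : |character S x| = 1 := by
  rcases character_eq_or S x with h | h <;> simp [h]

lemma character_mul_self (S x : Cube n) : character S x * character S x = 1 := by
  rcases character_eq_or S x with h | h <;> simp [h]

lemma character_of_dotProduct_ne_zero {S x : Cube n} (h : S ⬝ᵥ x ≠ 0) : character S x = -1 := by
  have : S ⬝ᵥ x = 1 := by
    generalize S ⬝ᵥ x = a at *
    revert a; decide
  simp [character, this, ZMod.val_one]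

lemma add_self_eq_zero_of_zmod_two {G : Type*} [AddCommGroup G] [Module (ZMod 2) G] (x : G) :
    x + x = 0 := by
  rw [← two_smul (ZMod 2) x]
  have : (2 : ZMod 2) = 0 := rfl
  rw [this, zero_smul]

lemma sum_character (S : Cube n) : ∑ x : Cube n, character S x = if S = 0 then 2 ^ n else 0 := by
  split_ifs with h
  · subst h; simp
  · obtain ⟨i, hi⟩ : ∃ i, S i ≠ 0 := by
      by_contra! h'; exact h (funext h')
    have h1 : character S (Pi.single i 1) = -1 :=
      character_of_dotProduct_ne_zero (by simpa using hi)
    have h2 : ∑ x : Cube n, character S x = ∑ x : Cube n, character S (x + Pi.single i 1) :=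
      (Equiv.sum_comp (Equiv.addRight (Pi.single i 1)) (fun x => character S x)).symm
    simp only [character_add_right, h1, mul_neg, mul_one, sum_neg_distrib] at h2
    linarith

lemma add_eq_zero_iff_eq_of_zmod_two {G : Type*} [AddCommGroup G] [Module (ZMod 2) G] (x y : G) :
    x + y = 0 ↔ x = y := by
  constructor
  · intro h
    have := add_self_eq_zero_of_zmod_two y
    exact add_right_cancel (h.trans this.symm)
  · rintro rfl; exact add_self_eq_zero_of_zmod_two x

lemma sum_character_mul (S S' : Cube n) :
    ∑ x : Cube n, character S x * character S' x = if S = S' then 2 ^ n else 0 := by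
  simp only [← character_add_left, sum_character, add_eq_zero_iff_eq_of_zmod_two]

/-- Fourier inversion. -/
lemma sum_cubeFourierCoeff_mul_character (f : Cube n → ℝ) (x : Cube n) :
    ∑ S, cubeFourierCoeff f S * character S x = f x := by
  have h2 : (2 : ℝ) ^ n ≠ 0 := by positivity
  simp only [cubeFourierCoeff, div_mul_eq_mul_div, ← sum_div, sum_mul]
  rw [sum_comm, div_eq_iff h2]
  calc ∑ y, ∑ S, f y * character S y * character S x
      = ∑ y, f y * ∑ S, character y S * character x S := by
        refine sum_congr rfl fun y _ => ?_
        rw [mul_sum]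
        exact sum_congr rfl fun S _ => by rw [character_comm S y, character_comm S x, mul_assoc]
    _ = f x * 2 ^ n := by simp [sum_character_mul]

/-- Parseval's identity, in terms of the coefficients. -/
lemma sum_sq_sum_character (a : Cube n → ℝ) :
    ∑ x : Cube n, (∑ S, a S * character S x) ^ 2 = 2 ^ n * ∑ S, a S ^ 2 := by
  have h : ∀ x : Cube n, (∑ S, a S * character S x) ^ 2
      = ∑ S, ∑ S', a S * a S' * (character S x * character S' x) := by
    intro x
    rw [sq, sum_mul_sum]
    exact sum_congr rfl fun S _ => sum_congr rfl fun S' _ => by ring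
  simp only [h]
  rw [sum_comm]
  have : ∀ S : Cube n, ∑ x, ∑ S', a S * a S' * (character S x * character S' x)
      = 2 ^ n * a S ^ 2 := by
    intro S
    rw [sum_comm]
    simp only [← mul_sum, sum_character_mul]
    simp; ring
  simp only [this, mul_sum]

lemma sum_sq_cubeFourierCoeff (f : Cube n → ℝ) :
    2 ^ n * ∑ S, cubeFourierCoeff f S ^ 2 = ∑ x, f x ^ 2 := by
  rw [← sum_sq_sum_character]
  simp only [sum_cubeFourierCoeff_mul_character]

/-- The uncertainty principle on the cube: a nonzero combination of `m` characters
vanishes on at most a fraction `1 - 1/m` of the cube. -/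
lemma two_pow_le_card_ne_zero_mul (a : Cube n → ℝ) (F : Finset (Cube n))
    (hF : ∀ S, a S ≠ 0 → S ∈ F) (ha : ∃ S, a S ≠ 0) :
    2 ^ n ≤ #{x : Cube n | ∑ S, a S * character S x ≠ 0} * #F := by
  set f : Cube n → ℝ := fun x => ∑ S, a S * character S x with hf
  have hpos : 0 < ∑ S, a S ^ 2 := by
    obtain ⟨S, hS⟩ := ha
    exact sum_pos' (fun _ _ => sq_nonneg _) ⟨S, mem_univ _, by positivity⟩
  have hsum : ∀ g : Cube n → ℝ, (∀ S, a S = 0 → g S = 0) → ∑ S, g S = ∑ S ∈ F, g S := by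
    intro g hg
    refine (sum_subset (subset_univ F) fun S _ hS => hg S ?_).symm
    by_contra h; exact hS (hF S h)
  -- Cauchy–Schwarz bounds `f²` pointwise by `#F` times `∑ a²`, which by Parseval is the mean of
  -- `f²`; hence `f` is nonzero on a fraction at least `1/#F`.
  have hb : ∀ x, f x ^ 2 ≤ #F * ∑ S, a S ^ 2 := by
    intro x
    have h1 : f x = ∑ S ∈ F, a S * character S x := hsum _ fun S h => by simp [h]
    have h2 : ∑ S, a S ^ 2 = ∑ S ∈ F, (a S * character S x) ^ 2 := by
      rw [hsum _ fun S h => by simp [h]]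
      exact sum_congr rfl fun S _ => by
        rw [mul_pow, sq (character S x), character_mul_self, mul_one]
    rw [h1, h2]
    exact sq_sum_le_card_mul_sum_sq
  have h3 : (2 : ℝ) ^ n * ∑ S, a S ^ 2
      ≤ (#{x : Cube n | f x ≠ 0} * #F) * ∑ S, a S ^ 2 := by
    rw [← sum_sq_sum_character]
    calc ∑ x, f x ^ 2 = ∑ x with f x ≠ 0, f x ^ 2 := by
          rw [sum_filter]
          refine sum_congr rfl fun x _ => ?_
          split_ifs with h
          · rfl
          · simp only [not_not] at h; simp [h]
      _ ≤ ∑ x with f x ≠ 0, #F * ∑ S, a S ^ 2 := sum_le_sum fun x _ => hb x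
      _ = _ := by rw [sum_const, nsmul_eq_mul, mul_assoc]
  have := le_of_mul_le_mul_right h3 hpos
  exact_mod_cast this

/-- The uncertainty principle in terms of the Fourier support. -/
lemma two_pow_le_card_ne_zero_mul_of_fourierSupport (f : Cube n → ℝ) (F : Finset (Cube n))
    (hF : fourierSupport f ⊆ F) (hf : f ≠ 0) :
    2 ^ n ≤ #{x : Cube n | f x ≠ 0} * #F := by
  have := two_pow_le_card_ne_zero_mul (cubeFourierCoeff f) F (fun S hS => hF hS) (by
    by_contra! h
    apply hf
    ext x
    rw [← sum_cubeFourierCoeff_mul_character f x]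
    simp [h])
  simpa only [sum_cubeFourierCoeff_mul_character] using this

lemma BoolFun.toReal_eq_or (c : BoolFun n) (x : Cube n) : c.toReal x = 1 ∨ c.toReal x = -1 := by
  rcases Int.units_eq_one_or (c x) with h | h <;> simp [BoolFun.toReal, h]

lemma BoolFun.toReal_injective : Function.Injective (BoolFun.toReal (n := n)) := by
  intro c c' h
  ext x
  have := congrFun h x
  simpa [BoolFun.toReal] using this

lemma BoolFun.sum_sq_cubeFourierCoeff (c : BoolFun n) :
    ∑ S, cubeFourierCoeff c.toReal S ^ 2 = 1 := by
  have h := QLearn.sum_sq_cubeFourierCoeff c.toReal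
  have h2 : ∀ x, c.toReal x ^ 2 = 1 := fun x => by
    rcases c.toReal_eq_or x with h | h <;> simp [h]
  simp only [h2, sum_const, card_univ, Fintype.card_pi, ZMod.card, prod_const, Fintype.card_fin,
    nsmul_eq_mul, mul_one] at h
  have h3 : (2 : ℝ) ^ n ≠ 0 := by positivity
  apply mul_left_cancel₀ h3
  rw [h]; simp

end

/-! ### Square roots of one in the real group algebra of an elementary abelian 2-group -/

/-- `f` squares to one under convolution (in characteristic two). -/
structure ConvSqOne {G : Type*} [AddCommGroup G] [Fintype G] (f : G → ℝ) : Prop where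
  sum_sq : ∑ S, f S * f S = 1
  sum_shift : ∀ D, D ≠ 0 → ∑ S, f S * f (S + D) = 0

lemma eq_zero_or_one_of_zmod_two (a : ZMod 2) : a = 0 ∨ a = 1 := by
  revert a; decide

lemma one_add_one_eq_zero_of_zmod_two : (1 + 1 : ZMod 2) = 0 := rfl

lemma add_add_cancel_of_zmod_two {G : Type*} [AddCommGroup G] [Module (ZMod 2) G] (x y : G) :
    x + y + y = x := by
  rw [add_assoc, add_self_eq_zero_of_zmod_two, add_zero]

lemma sum_add_right {G : Type*} [AddCommGroup G] [Fintype G] (D : G) (g : G → ℝ) :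
    ∑ S, g (S + D) = ∑ S, g S :=
  Equiv.sum_comp (Equiv.addRight D) g

lemma eq_of_add_mem_span_singleton {G : Type*} [AddCommGroup G] [Module (ZMod 2) G]
    {w : G →ₗ[ZMod 2] ZMod 2} {D y y' : G} (hw : w D = 1)
    (hy : w y = 0) (hy' : w y' = 0) (h : y + y' ∈ Submodule.span (ZMod 2) {D}) : y = y' := by
  obtain ⟨a, ha⟩ := Submodule.mem_span_singleton.mp h
  have := congrArg w ha
  rw [map_smul, hw, map_add, hy, hy', add_zero, smul_eq_mul, mul_one] at this
  rw [this, zero_smul] at ha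
  exact (add_eq_zero_iff_eq_of_zmod_two _ _).mp ha.symm

section Fold

variable {G : Type*} [AddCommGroup G] [Module (ZMod 2) G] [Fintype G]

/-- The fold of `f` along `D`, living on the hyperplane `w = 0`. -/
def fold (w : G →ₗ[ZMod 2] ZMod 2) (D : G) (ε : ℝ) (f : G → ℝ) (S : G) : ℝ :=
  if w S = 0 then f S + ε * f (S + D) else 0

/-- Since `w D = 1`, the hyperplane contains exactly one of `S` and `S + D`, which `g` does not
distinguish. -/
lemma sum_hyperplane_eq_half {w : G →ₗ[ZMod 2] ZMod 2} {D : G} (hw : w D = 1) {g : G → ℝ}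
    (hg : ∀ S, g (S + D) = g S) : ∑ S, (if w S = 0 then g S else 0) = (∑ S, g S) / 2 := by
  have h1 : ∑ S, (if w S = 0 then g S else 0) = ∑ S, (if w S = 0 then 0 else g S) := by
    rw [← Equiv.sum_comp (Equiv.addRight D)]
    refine sum_congr rfl fun S _ => ?_
    simp only [Equiv.coe_addRight, map_add, hw, hg]
    obtain h | h := eq_zero_or_one_of_zmod_two (w S)
    · simp [h]
    · simp [h, one_add_one_eq_zero_of_zmod_two]
  have h2 : ∑ S, g S = ∑ S, (if w S = 0 then g S else 0) + ∑ S, (if w S = 0 then 0 else g S) := by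
    rw [← sum_add_distrib]
    refine sum_congr rfl fun S _ => ?_
    split_ifs <;> simp
  linarith

/-- Sending `D` to the sign `ε` is a homomorphism from the group algebra of `G` to that of `G/⟨D⟩`,
modelled on the hyperplane, so it preserves square roots of one. For a Boolean function it is
restriction to the half-cube `χ_D = ε`. -/
lemma ConvSqOne.convSqOne_fold {f : G → ℝ} (hf : ConvSqOne f) {w : G →ₗ[ZMod 2] ZMod 2} {D : G}
    (hw : w D = 1) {ε : ℝ} (hε : ε * ε = 1) : ConvSqOne (fold w D ε f) := by
  have hD : D ≠ 0 := by rintro rfl; simp at hw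
  have key : ∀ E, w E = 0 → ∑ S, fold w D ε f S * fold w D ε f (S + E)
      = ∑ S, f S * f (S + E) + ε * ∑ S, f S * f (S + (E + D)) := by
    intro E hE
    have h1 : ∑ S, fold w D ε f S * fold w D ε f (S + E)
        = ∑ S, if w S = 0 then (f S + ε * f (S + D)) * (f (S + E) + ε * f (S + E + D)) else 0 := by
      refine sum_congr rfl fun S _ => ?_
      simp only [fold, map_add, hE, add_zero]
      split_ifs <;> simp
    rw [h1, sum_hyperplane_eq_half hw]
    · have e1 := sum_add_right D fun S => f S * f (S + E)
      have e2 := sum_add_right D fun S => f S * f (S + (E + D))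
      have e3 : ∀ S : G, S + D + (E + D) = S + E := fun S => by
        rw [add_add_add_comm, add_self_eq_zero_of_zmod_two, add_zero]
      simp only [e3] at e2
      simp only [add_right_comm _ D E] at e1
      rw [div_eq_iff two_ne_zero]
      calc ∑ S, (f S + ε * f (S + D)) * (f (S + E) + ε * f (S + E + D))
          = ∑ S, f S * f (S + E) + ε * ∑ S, f S * f (S + (E + D))
            + ε * ∑ S, f (S + D) * f (S + E) + (ε * ε) * ∑ S, f (S + D) * f (S + E + D) := by
            simp only [mul_sum, ← sum_add_distrib]
            refine sum_congr rfl fun S _ => ?_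
            rw [add_assoc S E D]; ring
        _ = _ := by rw [e1, e2, hε]; ring
    · intro S
      rw [add_add_cancel_of_zmod_two, add_right_comm S D E, add_add_cancel_of_zmod_two]
      linear_combination (f (S + D) * f (S + E + D) - f S * f (S + E)) * (-hε)
  constructor
  · have := key 0 (map_zero w)
    simp only [add_zero, zero_add] at this
    rw [this, hf.sum_sq, hf.sum_shift D hD]; simp
  · intro E hE
    by_cases h : w E = 0
    · rw [key E h, hf.sum_shift E hE, hf.sum_shift (E + D)]
      · simp
      · rw [Ne, add_eq_zero_iff_eq_of_zmod_two]
        rintro rfl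
        rw [hw] at h; exact one_ne_zero h
    · refine sum_eq_zero fun S _ => ?_
      simp only [fold, map_add]
      by_cases hS : w S = 0
      · simp [hS, h]
      · simp [hS]

/-- If `u` and `ε v` have equal signs the correction vanishes. If they are opposite, the loss in the
triangle inequality is `2 min(|u|, |v|)`, and `a * min(|u|, |v|) ≥ |u v|`. -/
lemma abs_add_mul_le {u v ε a : ℝ} (hε : ε = 1 ∨ ε = -1) (hu : |u| ≤ a) (hv : |v| ≤ a) :
    a * |u + ε * v| ≤ a * (|u| + |v|) - (|u * v| - ε * (u * v)) := by
  rw [abs_mul]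
  rcases hε with rfl | rfl <;>
  rcases abs_cases u with ⟨h1, h1'⟩ | ⟨h1, h1'⟩ <;> rcases abs_cases v with ⟨h2, h2'⟩ | ⟨h2, h2'⟩ <;>
  rcases abs_cases (u + 1 * v) with ⟨h3, h3'⟩ | ⟨h3, h3'⟩ <;>
  rcases abs_cases (u + -1 * v) with ⟨h4, h4'⟩ | ⟨h4, h4'⟩ <;>
  simp only [h1, h2, h3, h4] at * <;> nlinarith

/-- Because `∑ f S * f (S + D) = 0`, the reinforcing pair `S₁, S₂` forces equal cancellation among
the other pairs. Their entries are at most `|f S₂|`, so `abs_add_mul_le` turns this into a loss of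
norm of at least `2 |f S₁|`. -/
lemma sum_abs_fold_le {f : G → ℝ} (hf : ConvSqOne f) {S₁ S₂ : G} (hne : S₁ ≠ S₂)
    (h2 : f S₂ ≠ 0) (hmax : ∀ S, S ≠ S₁ → |f S| ≤ |f S₂|)
    {w : G →ₗ[ZMod 2] ZMod 2} (hw : w (S₁ + S₂) = 1) {ε : ℝ} (hε : ε = 1 ∨ ε = -1)
    (hs : ε * (f S₁ * f S₂) = |f S₁ * f S₂|) :
    ∑ S, |fold w (S₁ + S₂) ε f S| ≤ ∑ S, |f S| - 2 * |f S₁| := by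
  classical
  set D := S₁ + S₂ with hD
  have hDne : D ≠ 0 := by rwa [hD, Ne, add_eq_zero_iff_eq_of_zmod_two]
  have hε2 : ε * ε = 1 := by rcases hε with rfl | rfl <;> norm_num
  have e1 : S₁ + D = S₂ := by rw [hD, ← add_assoc, add_self_eq_zero_of_zmod_two, zero_add]
  have e2 : S₂ + D = S₁ := by rw [hD, add_left_comm, add_self_eq_zero_of_zmod_two, add_zero]
  have hfold : ∑ S, |fold w D ε f S| = (∑ S, |f S + ε * f (S + D)|) / 2 := by
    rw [← sum_hyperplane_eq_half hw]
    · refine sum_congr rfl fun S _ => ?_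
      rw [fold]; split_ifs <;> simp
    · intro S
      rw [add_add_cancel_of_zmod_two]
      have : f (S + D) + ε * f S = ε * (f S + ε * f (S + D)) := by
        linear_combination -(f (S + D)) * hε2
      rw [this, abs_mul]
      rcases hε with rfl | rfl <;> simp
  have hpt : ∀ S, |f S₂| * |f S + ε * f (S + D)|
      ≤ |f S₂| * (|f S| + |f (S + D)|) - (|f S * f (S + D)| - ε * (f S * f (S + D))) := by
    intro S
    -- Here `|f S₁|` may exceed `|f S₂|`, but nothing cancels on this pair.
    by_cases hS : S = S₁ ∨ S = S₂
    · have h0 : |f S * f (S + D)| - ε * (f S * f (S + D)) = 0 := by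
        rcases hS with rfl | rfl
        · rw [e1, hs, sub_self]
        · rw [e2, mul_comm (f S), hs, sub_self]
      rw [h0, sub_zero]
      refine mul_le_mul_of_nonneg_left ((abs_add_le _ _).trans ?_) (abs_nonneg _)
      rw [abs_mul]
      rcases hε with rfl | rfl <;> simp
    · push Not at hS
      refine abs_add_mul_le hε (hmax S hS.1) (hmax _ ?_)
      intro h
      apply hS.2
      rw [← add_add_cancel_of_zmod_two S D, h, e1]
  have hsum := sum_le_sum fun S (_ : S ∈ (univ : Finset G)) => hpt S
  -- The vanishing autocorrelation equates the total loss with this sum of nonnegative terms.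
  have h4 : 4 * (|f S₁| * |f S₂|) ≤ ∑ S, (|f S * f (S + D)| + ε * (f S * f (S + D))) := by
    have hnn : ∀ S, 0 ≤ |f S * f (S + D)| + ε * (f S * f (S + D)) := by
      intro S
      have h1 := neg_abs_le (f S * f (S + D))
      have h2 := le_abs_self (f S * f (S + D))
      rcases hε with rfl | rfl <;> linarith
    calc 4 * (|f S₁| * |f S₂|)
        = ∑ S ∈ {S₁, S₂}, (|f S * f (S + D)| + ε * (f S * f (S + D))) := by
          rw [sum_pair hne, e1, e2, mul_comm (f S₂), hs, abs_mul]; ring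
      _ ≤ _ := sum_le_sum_of_subset_of_nonneg (subset_univ _) fun S _ _ => hnn S
  have h0 : ∑ S, ε * (f S * f (S + D)) = 0 := by rw [← mul_sum, hf.sum_shift D hDne, mul_zero]
  have hA := sum_add_right D fun S => |f S|
  simp only [sum_sub_distrib, sum_add_distrib, ← mul_sum] at hsum h4 h0
  rw [hA] at hsum
  have hpos : 0 < |f S₂| := abs_pos.mpr h2
  rw [hfold]
  have : |f S₂| * ∑ S, |f S + ε * f (S + D)| ≤ |f S₂| * (2 * ∑ S, |f S| - 4 * |f S₁|) := by
    linarith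
  have := le_of_mul_le_mul_left this hpos
  linarith

/-- Modulo a subspace of dimension bounded by a spectral-norm potential, all but one class of the
support of `f` contains no or at least two elements of the support. -/
theorem ConvSqOne.exists_merging_aux {A : ℝ} (m : ℕ) : ∀ f : G → ℝ, ConvSqOne f → ∀ S₁,
    ∑ S, |f S| ≤ A → ∑ S, |f S| + 4 / 3 * A * (1 - |f S₁|) ≤ m →
    ∃ W : Submodule (ZMod 2) G, Module.finrank (ZMod 2) W ≤ m ∧ ∃ S₀, ∀ S, f S ≠ 0 →
      S + S₀ ∈ W ∨ ∃ S', S' ≠ S ∧ f S' ≠ 0 ∧ S' + S ∈ W := by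
  classical
  have habs : ∀ f : G → ℝ, ConvSqOne f → ∀ S, |f S| ≤ 1 := by
    intro f hf S
    rw [abs_le_one_iff_mul_self_le_one, ← hf.sum_sq]
    exact single_le_sum (f := fun S => f S * f S) (fun S _ => mul_self_nonneg _) (mem_univ S)
  have hnorm : ∀ f : G → ℝ, ConvSqOne f → 1 ≤ ∑ S, |f S| := by
    intro f hf
    rw [← hf.sum_sq]
    refine sum_le_sum fun S _ => ?_
    rw [← abs_mul_abs_self]
    exact mul_le_of_le_one_right (abs_nonneg _) (habs f hf S)
  induction m with
  | zero =>
    -- The norm alone is at least one, so the potential cannot be at most zero.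
    intro f hf S₁ hA hΨ
    have h1 := hnorm f hf
    have h2 := habs f hf S₁
    have : 0 ≤ 4 / 3 * A * (1 - |f S₁|) := mul_nonneg (by linarith) (by linarith)
    norm_num at hΨ
    linarith
  | succ m ih =>
    intro f hf S hA hΨ
    have hA1 : 1 ≤ A := (hnorm f hf).trans hA
    obtain ⟨S₁, hS₁⟩ := Finite.exists_max fun S => |f S|
    by_cases hsing : ∀ S, S ≠ S₁ → f S = 0
    · refine ⟨⊥, by simp, S₁, fun S hS => Or.inl ?_⟩
      have : S = S₁ := by by_contra h; exact hS (hsing S h)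
      rw [this, add_self_eq_zero_of_zmod_two]; exact zero_mem _
    push Not at hsing
    obtain ⟨S₃, hS₃, hS₃'⟩ := hsing
    obtain ⟨S₂, hS₂m, hS₂⟩ := exists_max_image (univ.erase S₁) (fun S => |f S|)
      ⟨S₃, by simp [hS₃]⟩
    have hne : S₁ ≠ S₂ := (ne_of_mem_erase hS₂m).symm
    have hmax : ∀ S, S ≠ S₁ → |f S| ≤ |f S₂| := fun S hS => hS₂ S (by simp [hS])
    have h2 : f S₂ ≠ 0 := by
      have := hmax S₃ hS₃
      have h3 := abs_pos.mpr hS₃'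
      exact abs_pos.mp (h3.trans_le this)
    set D := S₁ + S₂ with hD
    have hDne : D ≠ 0 := by rwa [hD, Ne, add_eq_zero_iff_eq_of_zmod_two]
    obtain ⟨w, hw⟩ : ∃ w : G →ₗ[ZMod 2] ZMod 2, w D = 1 := by
      by_contra! h
      apply hDne
      rw [← Module.forall_dual_apply_eq_zero_iff (ZMod 2)]
      intro w
      exact (eq_zero_or_one_of_zmod_two _).resolve_right (h w)
    obtain ⟨ε, hε, hs⟩ : ∃ ε : ℝ, (ε = 1 ∨ ε = -1) ∧ ε * (f S₁ * f S₂) = |f S₁ * f S₂| := by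
      rcases abs_choice (f S₁ * f S₂) with h | h
      · exact ⟨1, Or.inl rfl, by rw [h, one_mul]⟩
      · exact ⟨-1, Or.inr rfl, by rw [h]; ring⟩
    have hε2 : ε * ε = 1 := by rcases hε with rfl | rfl <;> norm_num
    have hl1 := sum_abs_fold_le hf hne h2 hmax hw hε hs
    have e1 : S₁ + D = S₂ := by rw [hD, ← add_assoc, add_self_eq_zero_of_zmod_two, zero_add]
    have e2 : S₂ + D = S₁ := by rw [hD, add_left_comm, add_self_eq_zero_of_zmod_two, add_zero]
    have habs2 : |f S₁ + ε * f S₂| = |f S₁| + |f S₂| := by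
      have : (f S₁ + ε * f S₂) ^ 2 = (|f S₁| + |f S₂|) ^ 2 := by
        rw [add_sq, add_sq, sq_abs, sq_abs, mul_assoc 2 |f S₁|, ← abs_mul, ← hs]
        linear_combination f S₂ ^ 2 * hε2
      rw [sq_eq_sq_iff_abs_eq_abs, abs_of_nonneg (a := |f S₁| + |f S₂|) (by positivity)] at this
      exact this
    obtain ⟨S₁', hS₁'⟩ : ∃ S₁', |fold w D ε f S₁'| = |f S₁| + |f S₂| := by
      rcases eq_zero_or_one_of_zmod_two (w S₁) with h | h
      · exact ⟨S₁, by rw [fold, if_pos h, e1, habs2]⟩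
      · have h' : w S₂ = 0 := by rw [← e1, map_add, h, hw]; rfl
        refine ⟨S₂, ?_⟩
        rw [fold, if_pos h', e2, ← habs2]
        have : f S₂ + ε * f S₁ = ε * (f S₁ + ε * f S₂) := by
          linear_combination -(f S₂) * hε2
        rw [this, abs_mul]
        rcases hε with rfl | rfl <;> simp
    -- If `|f S₁| ≥ 1/2`, the norm falls by `2 |f S₁| ≥ 1`. Otherwise the square mass off `S₁` is at
    -- least `3/4` and at most `A * |f S₂|`; the peak grows by `|f S₂|`, and the weight `4/3 * A`
    -- makes this a drop of one.
    have hdrop : ∑ S, |fold w D ε f S| + 4 / 3 * A * (1 - |fold w D ε f S₁'|) ≤ m := by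
      have hle : |f S| ≤ |f S₁| := hS₁ S
      have hΨ' : ∑ S, |f S| + 4 / 3 * A * (1 - |f S₁|) ≤ m + 1 := by
        have : 4 / 3 * A * (1 - |f S₁|) ≤ 4 / 3 * A * (1 - |f S|) :=
          mul_le_mul_of_nonneg_left (by linarith) (by linarith)
        push_cast at hΨ
        linarith
      rw [hS₁']
      rcases le_total (1 / 2) |f S₁| with hbig | hsmall
      · have : 0 ≤ 4 / 3 * A * |f S₂| := by positivity
        linarith
      · have hA2 : 3 / 4 ≤ A * |f S₂| := by
          have hsq := hf.sum_sq
          rw [← add_sum_erase univ _ (mem_univ S₁)] at hsq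
          have h3 : f S₁ * f S₁ ≤ 1 / 4 := by
            rw [← abs_mul_abs_self]
            nlinarith [abs_nonneg (f S₁)]
          have h4 : ∑ S ∈ univ.erase S₁, f S * f S ≤ ∑ S ∈ univ.erase S₁, |f S| * |f S₂| := by
            refine sum_le_sum fun S hS => ?_
            rw [← abs_mul_abs_self]
            exact mul_le_mul_of_nonneg_left (hS₂ S hS) (abs_nonneg _)
          rw [← sum_mul] at h4
          have h5 : ∑ S ∈ univ.erase S₁, |f S| ≤ A :=
            (sum_le_sum_of_subset_of_nonneg (subset_univ _) fun _ _ _ => abs_nonneg _).trans hA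
          have := mul_le_mul_of_nonneg_right h5 (abs_nonneg (f S₂))
          linarith
        have := abs_nonneg (f S₁)
        linarith
    obtain ⟨W, hWr, S₀, hW⟩ := ih (fold w D ε f) (hf.convSqOne_fold hw hε2) S₁'
      (hl1.trans (by have := abs_nonneg (f S₁); linarith)) hdrop
    have hlift : ∀ S, ∃ y, w y = 0 ∧ y + S ∈ Submodule.span (ZMod 2) {D} ∧
        fold w D ε f y = f y + ε * f (y + D) ∧ (y = S ∨ y + D = S) := by
      intro S
      rcases eq_zero_or_one_of_zmod_two (w S) with h | h
      · exact ⟨S, h, by rw [add_self_eq_zero_of_zmod_two]; exact zero_mem _,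
          by rw [fold, if_pos h], Or.inl rfl⟩
      · have h' : w (S + D) = 0 := by rw [map_add, h, hw]; rfl
        refine ⟨S + D, h', ?_, by rw [fold, if_pos h'], Or.inr (add_add_cancel_of_zmod_two _ _)⟩
        rw [add_right_comm, add_self_eq_zero_of_zmod_two, zero_add]
        exact Submodule.mem_span_singleton_self D
    have hDW : Submodule.span (ZMod 2) {D} ≤ W ⊔ Submodule.span (ZMod 2) {D} := le_sup_right
    refine ⟨W ⊔ Submodule.span (ZMod 2) {D}, ?_, S₀, fun S hS => ?_⟩
    · refine (Submodule.finrank_add_le_finrank_add_finrank _ _).trans (add_le_add hWr ?_)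
      rw [finrank_span_singleton hDne]
    · obtain ⟨y, hwy, hyS, hfy, hyS'⟩ := hlift S
      -- A zero of the fold here is a cancellation, so `S + D` is also in the support and merges
      -- with `S` modulo `D`.
      by_cases hy0 : fold w D ε f y = 0
      · right
        have hfD : f (S + D) ≠ 0 := by
          intro h0
          rw [hfy] at hy0
          apply hS
          rcases hyS' with rfl | rfl
          · simpa [h0] using hy0
          · rw [add_add_cancel_of_zmod_two] at h0
            rw [h0, zero_add] at hy0
            rcases mul_eq_zero.mp hy0 with h | h
            · rw [h] at hε2; norm_num at hε2
            · exact h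
        refine ⟨S + D, ?_, hfD, ?_⟩
        · simpa using hDne
        · rw [add_right_comm, add_self_eq_zero_of_zmod_two, zero_add]
          exact hDW (Submodule.mem_span_singleton_self D)
      · rcases hW y hy0 with h | ⟨y', hne', hy', hyy⟩
        · left
          have : S + S₀ = (y + S) + (y + S₀) := by
            rw [add_add_add_comm, add_self_eq_zero_of_zmod_two, zero_add]
          rw [this]
          exact add_mem (hDW hyS) (le_sup_left (a := W) h)
        · right
          have hwy' : w y' = 0 := by
            by_contra h; exact hy' (by rw [fold, if_neg h])
          obtain ⟨S', hfS', hyT⟩ : ∃ S', f S' ≠ 0 ∧ y' + S' ∈ Submodule.span (ZMod 2) {D} := by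
            by_cases h0 : f y' = 0
            · refine ⟨y' + D, fun h1 => hy' ?_, ?_⟩
              · rw [fold, if_pos hwy', h0, h1]; simp
              · rw [← add_assoc, add_self_eq_zero_of_zmod_two, zero_add]
                exact Submodule.mem_span_singleton_self D
            · exact ⟨y', h0, by rw [add_self_eq_zero_of_zmod_two]; exact zero_mem _⟩
          refine ⟨S', ?_, hfS', ?_⟩
          · rintro rfl
            apply hne'
            refine eq_of_add_mem_span_singleton hw hwy' hwy ?_
            have := add_mem hyT hyS
            rwa [add_add_add_comm, add_self_eq_zero_of_zmod_two, add_zero] at this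
          · have : S' + S = (y' + S') + ((y' + y) + (y + S)) := by
              have h1 : (y' + y) + (y + S) = y' + S := by
                rw [add_assoc, ← add_assoc y y S, add_self_eq_zero_of_zmod_two, zero_add]
              rw [h1, add_add_add_comm, add_self_eq_zero_of_zmod_two, zero_add]
            rw [this]
            exact add_mem (hDW hyT) (add_mem (le_sup_left (a := W) hyy) (hDW hyS))

/-- A Boolean function of Fourier sparsity `q` becomes constant after fixing `O(√q)` parities; in
particular these parities merge all but one element of the support with another one. -/
theorem ConvSqOne.exists_merging {f : G → ℝ} (hf : ConvSqOne f) {F : Finset G}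
    (hF : ∀ S, f S ≠ 0 → S ∈ F) :
    ∃ W : Submodule (ZMod 2) G, (Module.finrank (ZMod 2) W : ℝ) ≤ 4 * √(#F) ∧
      ∃ S₀, ∀ S, f S ≠ 0 → S + S₀ ∈ W ∨ ∃ S', S' ≠ S ∧ f S' ≠ 0 ∧ S' + S ∈ W := by
  have hsupp : ∀ g : G → ℝ, (∀ S, f S = 0 → g S = 0) → ∑ S, g S = ∑ S ∈ F, g S := by
    intro g hg
    refine (sum_subset (subset_univ F) fun S _ hS => hg S ?_).symm
    by_contra h; exact hS (hF S h)
  have hA : ∑ S, |f S| ≤ √(#F) := by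
    apply Real.le_sqrt_of_sq_le
    rw [hsupp _ fun S h => by simp [h]]
    refine sq_sum_le_card_mul_sum_sq.trans ?_
    have : ∑ S ∈ F, |f S| ^ 2 = 1 := by
      rw [← hf.sum_sq, hsupp _ fun S h => by simp [h]]
      exact sum_congr rfl fun S _ => by rw [sq_abs, sq]
    rw [this, mul_one]
  have hone : 1 ≤ √(#F : ℝ) := by
    rw [Real.one_le_sqrt]
    have : F.Nonempty := by
      by_contra h
      rw [not_nonempty_iff_eq_empty] at h
      have h1 := hf.sum_sq
      rw [hsupp _ fun S h => by simp [h], h] at h1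
      simp at h1
    exact_mod_cast this.card_pos
  -- The potential starts at no more than `A + 4/3 * A`; since `√#F ≥ 1`, the constant `4` absorbs
  -- the rounding.
  obtain ⟨W, hW, h⟩ := ConvSqOne.exists_merging_aux (A := √(#F)) ⌈7 / 3 * √(#F)⌉₊ f hf 0 hA (by
    refine le_trans ?_ (Nat.le_ceil _)
    have : 0 ≤ 4 / 3 * √(#F : ℝ) * |f 0| := by positivity
    linarith)
  refine ⟨W, ?_, h⟩
  have h1 : (Module.finrank (ZMod 2) W : ℝ) ≤ (⌈7 / 3 * √(#F : ℝ)⌉₊ : ℝ) := by exact_mod_cast hW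
  have h2 := Nat.ceil_lt_add_one (a := 7 / 3 * √(#F : ℝ)) (by positivity)
  linarith

end Fold

section

variable {n : ℕ}

/-! ### The Fourier dimension of a Fourier-sparse Boolean function -/

/-- Mapping a set by `p` loses about half of a subset all but one of whose fibres under `p` have at
least two elements. -/
lemma two_mul_card_image_add_card_le {H K : Type*} [DecidableEq H] [DecidableEq K]
    (I Q : Finset H) (hQ : Q ⊆ I) (p : H → K) (z : K)
    (h : ∀ y ∈ Q, p y = z ∨ ∃ y' ∈ Q, y' ≠ y ∧ p y' = p y) :
    2 * #(I.image p) + #Q ≤ 2 * #I + 1 := by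
  have h1 : #(I.image p) ≤ #(I \ Q) + #(Q.image p) := by
    calc #(I.image p) = #((I \ Q).image p ∪ Q.image p) := by
          rw [← image_union, sdiff_union_of_subset hQ]
      _ ≤ _ := (card_union_le _ _).trans (Nat.add_le_add_right card_image_le _)
  have h2 := card_sdiff_add_card_eq_card hQ
  set Q' := {y ∈ Q | p y ≠ z} with hQ'
  have h3 : 2 * #(Q'.image p) ≤ #Q' := by
    refine mul_card_image_le_card _ _ fun b hb => ?_
    obtain ⟨y, hy, rfl⟩ := mem_image.mp hb
    rw [hQ', mem_filter] at hy
    obtain ⟨y', hy'Q, hne, hpy⟩ := (h y hy.1).resolve_left hy.2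
    have : ({y, y'} : Finset H) ⊆ {a ∈ Q' | p a = p y} := by
      intro u hu
      simp only [mem_insert, mem_singleton] at hu
      rcases hu with rfl | rfl
      · simp [hQ', hy]
      · simp [hQ', hy'Q, hpy, hy.2]
    rw [← card_pair hne.symm]
    exact card_le_card this
  -- Only the fibre over `z` may be a singleton, whence the `+ 1`.
  have h4 : 2 * #(Q.image p) ≤ #Q + 1 := by
    have hsplit := card_filter_add_card_filter_not (s := Q) (fun y => p y ≠ z)
    rw [← hQ'] at hsplit
    by_cases hz : ∃ y ∈ Q, p y = z
    · obtain ⟨y, hy, hyz⟩ := hz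
      have hpos : 0 < #{y ∈ Q | ¬ p y ≠ z} := card_pos.mpr ⟨y, by simp [hy, hyz]⟩
      have hsub : Q.image p ⊆ insert z (Q'.image p) := by
        intro u hu
        obtain ⟨y, hy, rfl⟩ := mem_image.mp hu
        by_cases hyz : p y = z
        · simp [hyz]
        · exact mem_insert_of_mem (mem_image_of_mem _ (by simp [hQ', hy, hyz]))
      have := (card_le_card hsub).trans (card_insert_le _ _)
      omega
    · have : Q' = Q := filter_true_of_mem fun y hy hyz => hz ⟨y, hy, hyz⟩
      rw [this] at h3
      omega
  omega

section Push

variable {G H : Type*} [AddCommGroup G] [AddCommGroup H] [Fintype G]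

open scoped Classical in
/-- The push-forward of a function along `φ`: sums over fibres. -/
noncomputable def push (φ : G → H) (b : G → ℝ) (y : H) : ℝ := ∑ S, if φ S = y then b S else 0

/-- Push-forward is a homomorphism of group algebras. On the spectrum of `c`, twisted by `S ↦
χ_S(x)`, it gives the spectrum of a restriction of `c` to a coset. -/
lemma ConvSqOne.convSqOne_push [Module (ZMod 2) G] [Module (ZMod 2) H] [Fintype H] {b : G → ℝ}
    (hb : ConvSqOne b) (φ : G →ₗ[ZMod 2] H) : ConvSqOne (push φ b) := by
  classical
  have key : ∀ E, ∑ y, push φ b y * push φ b (y + E) = if E = 0 then 1 else 0 := by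
    intro E
    calc ∑ y, push φ b y * push φ b (y + E)
        = ∑ S, ∑ S', if φ S' = φ S + E then b S * b S' else 0 := by
          simp only [push, sum_mul_sum]
          rw [sum_comm]
          refine sum_congr rfl fun S _ => ?_
          rw [sum_comm]
          refine sum_congr rfl fun S' _ => ?_
          rw [sum_eq_single (φ S) (fun y _ hy => by simp [hy.symm]) (by simp)]
          simp
      _ = ∑ S, ∑ D, if φ D = E then b S * b (S + D) else 0 := by
          refine sum_congr rfl fun S _ => ?_
          rw [← Equiv.sum_comp (Equiv.addLeft S)]
          simp
      _ = ∑ D, if φ D = E then (if D = 0 then 1 else 0) else 0 := by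
          rw [sum_comm]
          refine sum_congr rfl fun D _ => ?_
          split_ifs with h1 h2
          · rw [h2]; simpa using hb.sum_sq
          · exact hb.sum_shift D h2
          · simp
      _ = if E = 0 then 1 else 0 := by
          rw [sum_eq_single 0 (fun D _ hD => by simp [hD]) (by simp)]
          simp [eq_comm]
  exact ⟨by simpa using key 0, fun D hD => by simpa [hD] using key D⟩

end Push

/-- `S ↦ χ_S(x)` is multiplicative, so the twist is an automorphism of the group algebra; on spectra
it is translation by `x`. -/
lemma ConvSqOne.mul_character {a : Cube n → ℝ} (ha : ConvSqOne a) (x : Cube n) :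
    ConvSqOne fun S => a S * character S x := by
  have h : ∀ S D, a S * character S x * (a (S + D) * character (S + D) x)
      = character D x * (a S * a (S + D)) := by
    intro S D
    rw [character_add_left]
    linear_combination (a S * a (S + D) * character D x) * character_mul_self S x
  constructor
  · rw [← ha.sum_sq]
    refine sum_congr rfl fun S _ => ?_
    linear_combination (a S * a S) * character_mul_self S x
  · intro D hD
    simp only [h, ← mul_sum, ha.sum_shift D hD, mul_zero]

/-- The identity `c² = 1`, read on the Fourier side. -/
lemma BoolFun.convSqOne (c : BoolFun n) : ConvSqOne (cubeFourierCoeff c.toReal) := by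
  constructor
  · simpa only [sq] using c.sum_sq_cubeFourierCoeff
  · intro D hD
    have hc : ∀ x, c.toReal x * c.toReal x = 1 := fun x => by
      rcases c.toReal_eq_or x with h | h <;> simp [h]
    have h : ∑ x : Cube n, c.toReal x * c.toReal x * character D x = 0 := by
      simp [hc, sum_character, hD]
    calc ∑ S, cubeFourierCoeff c.toReal S * cubeFourierCoeff c.toReal (S + D)
        = (∑ x, c.toReal x * character D x *
            ∑ S, cubeFourierCoeff c.toReal S * character S x) / 2 ^ n := by
          simp only [mul_sum, sum_div]
          rw [sum_comm]
          refine sum_congr rfl fun S _ => ?_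
          rw [cubeFourierCoeff.eq_1 c.toReal (S + D), sum_div, mul_sum]
          refine sum_congr rfl fun x _ => ?_
          rw [character_add_left]; ring
      _ = (∑ x, c.toReal x * c.toReal x * character D x) / 2 ^ n := by
          congr 1
          refine sum_congr rfl fun x _ => ?_
          rw [sum_cubeFourierCoeff_mul_character]; ring
      _ = 0 := by rw [h, zero_div]

/-- Among all restrictions to the cosets of the annihilator of `ker φ`, one has large sparsity. -/
lemma exists_sq_card_image_le {H : Type*} [AddCommGroup H] [Module (ZMod 2) H] [Fintype H]
    [DecidableEq H] (a : Cube n → ℝ) (F : Finset (Cube n)) (hF : ∀ S, a S ≠ 0 ↔ S ∈ F)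
    (hne : F.Nonempty) (φ : Cube n →ₗ[ZMod 2] H) :
    ∃ x, #(F.image φ) ^ 2
      ≤ #F * #{y | push φ (fun S => a S * character S x) y ≠ 0} := by
  set g : Cube n → H → ℝ := fun x => push φ (fun S => a S * character S x) with hg
  -- By uncertainty, a fibre of size `m` has a nonzero sum for at least a fraction `1/m` of the
  -- points `x`.
  have hfib : ∀ y ∈ F.image φ, 2 ^ n ≤ #{x | g x y ≠ 0} * #{S ∈ F | φ S = y} := by
    intro y hy
    obtain ⟨S, hS, rfl⟩ := mem_image.mp hy
    have := two_pow_le_card_ne_zero_mul (fun S' => if φ S' = φ S then a S' else 0)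
      {S' ∈ F | φ S' = φ S} (fun S' h => by
        by_cases h' : φ S' = φ S
        · rw [if_pos h'] at h
          simp [h', (hF S').mp h]
        · simp [h'] at h) ⟨S, by simpa using (hF S).mpr hS⟩
    convert this using 5 with x
    simp only [hg, push, ite_mul, zero_mul]
    congr!
  have hpos : ∀ y ∈ F.image φ, (0 : ℝ) < #{S ∈ F | φ S = y} := by
    intro y hy
    obtain ⟨S, hS, rfl⟩ := mem_image.mp hy
    exact_mod_cast card_pos.mpr ⟨S, by simp [hS]⟩
  -- Cauchy–Schwarz: the reciprocals of the fibre sizes sum to at least `#(F.image φ)² / #F`, which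
  -- bounds the average number of surviving fibres.
  have hcs := sq_sum_div_le_sum_sq_div (F.image φ) (fun _ => (1 : ℝ)) hpos
  have hcard : ∑ y ∈ F.image φ, (#{S ∈ F | φ S = y} : ℝ) = #F := by
    rw [card_eq_sum_card_image φ F]; push_cast; rfl
  rw [hcard] at hcs
  simp only [sum_const, nsmul_eq_mul, mul_one, one_pow] at hcs
  have hFpos : (0 : ℝ) < #F := by exact_mod_cast hne.card_pos
  rw [div_le_iff₀ hFpos] at hcs
  have htot : ∑ _x : Cube n, (#(F.image φ) : ℝ) ^ 2
      ≤ ∑ x : Cube n, (#F : ℝ) * #{y | g x y ≠ 0} := by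
    have e1 : ∑ x : Cube n, #{y | g x y ≠ 0} = ∑ y, #{x | g x y ≠ 0} := by
      simp only [card_filter]
      exact sum_comm
    have e2 : ∑ y ∈ F.image φ, 2 ^ n * (1 / (#{S ∈ F | φ S = y} : ℝ))
        ≤ ∑ y, (#{x | g x y ≠ 0} : ℝ) := by
      refine (sum_le_sum fun y hy => ?_).trans (sum_le_sum_of_subset_of_nonneg
        (subset_univ _) fun _ _ _ => by positivity)
      rw [mul_one_div, div_le_iff₀ (hpos y hy)]
      exact_mod_cast hfib y hy
    rw [← mul_sum] at e2
    rw [← mul_sum]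
    have e3 : ∑ x : Cube n, (#{y | g x y ≠ 0} : ℝ) = ∑ y, (#{x | g x y ≠ 0} : ℝ) := by
      exact_mod_cast e1
    rw [e3]
    calc ∑ _x : Cube n, (#(F.image φ) : ℝ) ^ 2 = 2 ^ n * (#(F.image φ) : ℝ) ^ 2 := by simp
      _ ≤ 2 ^ n * ((∑ y ∈ F.image φ, 1 / (#{S ∈ F | φ S = y} : ℝ)) * #F) := by gcongr
      _ = #F * (2 ^ n * ∑ y ∈ F.image φ, 1 / (#{S ∈ F | φ S = y} : ℝ)) := by ring
      _ ≤ _ := by gcongr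
  obtain ⟨x, -, hx⟩ := exists_le_of_sum_le ⟨0, mem_univ _⟩ htot
  exact ⟨x, by exact_mod_cast hx⟩

lemma finrank_le_finrank_ker_add_finrank_map {G H : Type*} [AddCommGroup G] [AddCommGroup H]
    [Module (ZMod 2) G] [Module (ZMod 2) H] [Module.Finite (ZMod 2) G]
    (φ : G →ₗ[ZMod 2] H) (P : Submodule (ZMod 2) G) :
    Module.finrank (ZMod 2) P
      ≤ Module.finrank (ZMod 2) (LinearMap.ker φ) + Module.finrank (ZMod 2) (P.map φ) := by
  have h1 := (φ.domRestrict P).finrank_range_add_finrank_ker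
  rw [LinearMap.range_domRestrict] at h1
  have h2 : Module.finrank (ZMod 2) (LinearMap.ker (φ.domRestrict P))
      ≤ Module.finrank (ZMod 2) (LinearMap.ker φ) := by
    rw [← Submodule.finrank_map_subtype_eq]
    refine Submodule.finrank_mono ?_
    rintro _ ⟨y, hy, rfl⟩
    exact hy
  omega

/-- The kernel of `φ` records the dimension already paid. If `L² ≤ 2 #F`, the `L` image points span
what is left. Otherwise some restriction has sparsity `q ≥ L²/#F ≥ 2`, and dividing by a `W` of
dimension at most `4√q` removes at least `(q - 1)/2 ≥ q/4` image points. -/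
theorem ConvSqOne.finrank_span_le_aux {a : Cube n → ℝ} (ha : ConvSqOne a) {F : Finset (Cube n)}
    (hF : ∀ S, a S ≠ 0 ↔ S ∈ F) (hne : F.Nonempty) (L : ℕ) :
    ∀ (H : Type) [AddCommGroup H] [Module (ZMod 2) H] [Finite H] [DecidableEq H]
      (φ : Cube n →ₗ[ZMod 2] H), #(F.image φ) = L →
      (Module.finrank (ZMod 2) (Submodule.span (ZMod 2) (F : Set (Cube n))) : ℝ)
        ≤ Module.finrank (ZMod 2) (LinearMap.ker φ) + 16 * √(#F) * Real.log L + √(2 * #F) := by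
  induction L using Nat.strong_induction_on with
  | _ L ih =>
  intro H _ _ _ _ φ hL
  have : Fintype H := Fintype.ofFinite H
  have hLpos : 0 < L := hL ▸ (hne.image φ).card_pos
  have hL1 : (1 : ℝ) ≤ L := by exact_mod_cast hLpos
  have hFpos : (0 : ℝ) < #F := by exact_mod_cast hne.card_pos
  rcases le_total ((L : ℝ) ^ 2) (2 * #F) with hsmall | hbig
  · have h1 := finrank_le_finrank_ker_add_finrank_map φ
      (Submodule.span (ZMod 2) (F : Set (Cube n)))
    have h2 : Module.finrank (ZMod 2)
        ((Submodule.span (ZMod 2) (F : Set (Cube n))).map φ) ≤ L := by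
      rw [Submodule.map_span, ← coe_image, ← hL]
      exact finrank_span_finset_le_card _
    have h3 : (L : ℝ) ≤ √(2 * #F) := Real.le_sqrt_of_sq_le hsmall
    have h4 : 0 ≤ 16 * √(#F : ℝ) * Real.log L :=
      mul_nonneg (by positivity) (Real.log_nonneg hL1)
    have h5 : (Module.finrank (ZMod 2) (Submodule.span (ZMod 2) (F : Set (Cube n))) : ℝ)
        ≤ Module.finrank (ZMod 2) (LinearMap.ker φ) + L := by exact_mod_cast h1.trans (by omega)
    linarith
  · obtain ⟨x, hx⟩ := exists_sq_card_image_le a F hF hne φ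
    set g := push φ (fun S => a S * character S x) with hg
    set Q : Finset H := {y | g y ≠ 0} with hQ
    obtain ⟨W, hW, z, hz⟩ := ((ha.mul_character x).convSqOne_push φ).exists_merging (F := Q)
      (fun S hS => by simpa [hQ] using hS)
    classical
    have hQI : Q ⊆ F.image φ := by
      intro y hy
      by_contra hyI
      simp only [hQ, mem_filter, mem_univ, true_and] at hy
      apply hy
      refine sum_eq_zero fun S _ => ?_
      split_ifs with h
      · have : a S = 0 := by
          by_contra h0
          exact hyI (h ▸ mem_image_of_mem _ ((hF S).mp h0))
        simp [this]
      · rfl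
    have hcount := two_mul_card_image_add_card_le (F.image φ) Q hQI W.mkQ (W.mkQ z) (by
      intro y hy
      simp only [hQ, mem_filter, mem_univ, true_and] at hy
      have hmk : ∀ u v : H, u + v ∈ W → W.mkQ u = W.mkQ v := by
        intro u v huv
        rw [Submodule.mkQ_apply, Submodule.mkQ_apply, Submodule.Quotient.eq]
        have : u - v = u + v := by
          rw [sub_eq_add_neg, neg_eq_of_add_eq_zero_left (add_self_eq_zero_of_zmod_two v)]
        rwa [this]
      rcases hz y hy with h | ⟨y', hne', hy', h⟩
      · exact Or.inl (hmk _ _ h)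
      · exact Or.inr ⟨y', by simpa [hQ] using hy', hne', hmk _ _ h⟩)
    rw [image_image, ← LinearMap.coe_comp, hL] at hcount
    rw [hL] at hx
    set L' := #(F.image (W.mkQ ∘ₗ φ)) with hL'
    have hq : (L : ℝ) ^ 2 ≤ #F * #Q := by exact_mod_cast hx
    have hQ2 : (2 : ℝ) ≤ #Q := by
      by_contra h
      push Not at h
      nlinarith
    have hcount' : 2 * (L' : ℝ) + #Q ≤ 2 * L + 1 := by exact_mod_cast hcount
    have hL'L : L' < L := by
      have : 2 ≤ #Q := by exact_mod_cast hQ2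
      omega
    have hL'pos : 0 < L' := (hne.image _).card_pos
    have := ih L' hL'L (H ⧸ W) (W.mkQ ∘ₗ φ) rfl
    have hker : Module.finrank (ZMod 2) (LinearMap.ker (W.mkQ ∘ₗ φ))
        ≤ Module.finrank (ZMod 2) (LinearMap.ker φ) + Module.finrank (ZMod 2) W := by
      refine (finrank_le_finrank_ker_add_finrank_map φ _).trans (Nat.add_le_add_left ?_ _)
      refine Submodule.finrank_mono ?_
      rw [LinearMap.ker_comp, Submodule.ker_mkQ]
      exact Submodule.map_comap_le _ _
    have hker' : (Module.finrank (ZMod 2) (LinearMap.ker (W.mkQ ∘ₗ φ)) : ℝ)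
        ≤ Module.finrank (ZMod 2) (LinearMap.ker φ) + Module.finrank (ZMod 2) W := by
      exact_mod_cast hker
    have hLpos' : (0 : ℝ) < L := by linarith
    -- The cost of `W` is at most `16 √#F` times this relative decrease, so bounding it by a
    -- difference of logarithms makes the costs telescope.
    have hlog : ((L : ℝ) - L') / L ≤ Real.log L - Real.log L' := by
      have hr : (0 : ℝ) < L' := by exact_mod_cast hL'pos
      have := Real.log_le_sub_one_of_pos (div_pos hr hLpos')
      rw [Real.log_div hr.ne' hLpos'.ne'] at this
      rw [sub_div, div_self hLpos'.ne']
      linarith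
    have hcost : 4 * √(#Q : ℝ) ≤ 16 * √(#F : ℝ) * (((L : ℝ) - L') / L) := by
      have hs : (L : ℝ) ≤ √(#F) * √(#Q) := by
        rw [← Real.sqrt_mul hFpos.le]
        exact Real.le_sqrt_of_sq_le hq
      have hqq : √(#Q : ℝ) * √(#Q : ℝ) = #Q := Real.mul_self_sqrt (by linarith)
      have h4 : (#Q : ℝ) ≤ 4 * (L - L') := by linarith
      rw [← mul_div_assoc, le_div_iff₀ hLpos']
      calc 4 * √(#Q : ℝ) * L ≤ 4 * √(#Q : ℝ) * (√(#F) * √(#Q)) := by gcongr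
        _ = 4 * √(#F : ℝ) * (√(#Q) * √(#Q)) := by ring
        _ = 4 * √(#F : ℝ) * #Q := by rw [hqq]
        _ ≤ 4 * √(#F : ℝ) * (4 * (L - L')) := by gcongr
        _ = _ := by ring
    have := mul_le_mul_of_nonneg_left hlog (by positivity : 0 ≤ 16 * √(#F : ℝ))
    linarith

/-- The Fourier dimension of a `k`-Fourier-sparse Boolean function is `O(√k log k)`. -/
theorem BoolFun.finrank_span_fourierSupport_le (c : BoolFun n) {k : ℕ}
    (hc : (fourierSupport c.toReal).ncard ≤ k) :
    (Module.finrank (ZMod 2) (Submodule.span (ZMod 2) (fourierSupport c.toReal)) : ℝ)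
      ≤ 16 * √k * Real.log k + √(2 * k) := by
  classical
  set F : Finset (Cube n) := {S | cubeFourierCoeff c.toReal S ≠ 0} with hF
  have hco : (F : Set (Cube n)) = fourierSupport c.toReal := by
    ext S; simp [hF, fourierSupport]
  have hne : F.Nonempty := by
    by_contra h
    rw [not_nonempty_iff_eq_empty, hF, filter_eq_empty_iff] at h
    have h1 := c.sum_sq_cubeFourierCoeff
    push Not at h
    simp [h] at h1
  have h := c.convSqOne.finrank_span_le_aux (F := F) (by simp [hF]) hne _ _ LinearMap.id rfl
  rw [← hco, Set.ncard_coe_finset] at hc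
  rw [hco, LinearMap.ker_id, finrank_bot, LinearMap.id_coe, image_id, Nat.cast_zero, zero_add] at h
  have hpos : (0 : ℝ) < #F := by exact_mod_cast hne.card_pos
  have hc' : (#F : ℝ) ≤ k := by exact_mod_cast hc
  have h1 : (1 : ℝ) ≤ #F := by exact_mod_cast hne.card_pos
  refine h.trans ?_
  have := Real.log_nonneg h1
  gcongr

end

section

variable {n : ℕ}

/-! ### Approximation by short sums of random atoms -/

section Approx

variable {α X : Type*} [Fintype α] [Fintype X]

/-- A Chernoff bound for a sum of `N` independent bounded variables on a finite space. -/
lemma sum_prod_ite_le_exp (p f : α → ℝ) (hp : ∀ a, 0 ≤ p a) (hp1 : ∑ a, p a = 1)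
    (hf : ∀ a, |f a| ≤ 1) (N : ℕ) {δ : ℝ} (hδ0 : 0 ≤ δ) (hδ : δ ≤ 2) :
    ∑ σ : Fin N → α, (if N * δ ≤ ∑ i, f (σ i) - N * ∑ a, p a * f a then ∏ i, p (σ i) else 0)
      ≤ Real.exp (-(N * δ ^ 2 / 4)) := by
  set m := ∑ a, p a * f a with hm
  -- Exponential Markov with parameter `δ / 2`, using `exp t ≤ 1 + t + t²` for `|t| ≤ 1`; this is
  -- where `δ ≤ 2` enters.
  have hmgf : ∑ a, p a * Real.exp (δ / 2 * (f a - m - δ)) ≤ Real.exp (-(δ ^ 2 / 4)) := by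
    have h1 : ∀ a, p a * Real.exp (δ / 2 * (f a - m - δ))
        = Real.exp (-(δ / 2 * (m + δ))) * (p a * Real.exp (δ / 2 * f a)) := by
      intro a
      rw [mul_left_comm, ← Real.exp_add]; ring_nf
    simp only [h1, ← mul_sum]
    have h2 : ∑ a, p a * Real.exp (δ / 2 * f a) ≤ Real.exp (δ / 2 * m + δ ^ 2 / 4) := by
      calc ∑ a, p a * Real.exp (δ / 2 * f a)
          ≤ ∑ a, p a * (1 + δ / 2 * f a + δ ^ 2 / 4) := by
            refine sum_le_sum fun a _ => mul_le_mul_of_nonneg_left ?_ (hp a)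
            have hfa := hf a
            have habs : |δ / 2 * f a| ≤ 1 := by
              rw [abs_mul, abs_of_nonneg (by linarith : 0 ≤ δ / 2)]
              exact mul_le_one₀ (by linarith) (abs_nonneg _) hfa
            have h := (abs_le.mp (Real.abs_exp_sub_one_sub_id_le habs)).2
            have hsq : f a ^ 2 ≤ 1 := (sq_le_one_iff_abs_le_one _).mpr hfa
            nlinarith [sq_nonneg δ]
        _ = δ / 2 * m + δ ^ 2 / 4 + 1 := by
            have : ∀ a, p a * (1 + δ / 2 * f a + δ ^ 2 / 4)
                = (1 + δ ^ 2 / 4) * p a + δ / 2 * (p a * f a) := fun a => by ring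
            simp only [this, sum_add_distrib, ← mul_sum, hp1, ← hm]; ring
        _ ≤ _ := Real.add_one_le_exp _
    refine (mul_le_mul_of_nonneg_left h2 (Real.exp_pos _).le).trans ?_
    rw [← Real.exp_add]
    apply le_of_eq; congr 1; ring
  calc ∑ σ : Fin N → α, (if N * δ ≤ ∑ i, f (σ i) - N * m then ∏ i, p (σ i) else 0)
      ≤ ∑ σ : Fin N → α, ∏ i, (p (σ i) * Real.exp (δ / 2 * (f (σ i) - m - δ))) := by
        refine sum_le_sum fun σ _ => ?_
        have hnn : 0 ≤ ∏ i, p (σ i) := prod_nonneg fun i _ => hp _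
        rw [prod_mul_distrib, ← Real.exp_sum]
        split_ifs with h
        · refine le_mul_of_one_le_right hnn (Real.one_le_exp ?_)
          rw [← mul_sum, sum_sub_distrib, sum_sub_distrib]
          simp only [sum_const, card_univ, Fintype.card_fin, nsmul_eq_mul]
          exact mul_nonneg (by linarith) (by linarith)
        · positivity
    _ = (∑ a, p a * Real.exp (δ / 2 * (f a - m - δ))) ^ N :=
        (Fintype.sum_pow (fun a => p a * Real.exp (δ / 2 * (f a - m - δ))) N).symm
    _ ≤ Real.exp (-(δ ^ 2 / 4)) ^ N := by
        refine pow_le_pow_left₀ (sum_nonneg fun a _ => ?_) hmgf N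
        exact mul_nonneg (hp a) (Real.exp_pos _).le
    _ = _ := by rw [← Real.exp_nat_mul]; congr 1; ring

/-- Maurey's empirical method: a function in the convex hull of bounded atoms is close, outside an
exponentially small set, to an average of `N` atoms. -/
lemma exists_card_approx_le (p : α → ℝ) (f : α → X → ℝ) (h : X → ℝ) (hp : ∀ a, 0 ≤ p a)
    (hp1 : ∑ a, p a = 1) (hf : ∀ a x, |f a x| ≤ 1) (hh : ∀ x, ∑ a, p a * f a x = h x)
    (N : ℕ) {δ : ℝ} (hδ0 : 0 ≤ δ) (hδ : δ ≤ 2) :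
    ∃ σ : Fin N → α, (#{x | N * δ ≤ |∑ i, f (σ i) x - N * h x|} : ℝ)
      ≤ 2 * Real.exp (-(N * δ ^ 2 / 4)) * Fintype.card X := by
  set B : ℝ := 2 * Real.exp (-(N * δ ^ 2 / 4)) * Fintype.card X with hB
  have hw1 : ∑ σ : Fin N → α, ∏ i, p (σ i) = 1 := by
    rw [← Fintype.sum_pow, hp1, one_pow]
  have hw : ∀ σ : Fin N → α, 0 ≤ ∏ i, p (σ i) := fun σ => prod_nonneg fun i _ => hp _
  have htwo : ∀ x, ∑ σ : Fin N → α,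
      (if N * δ ≤ |∑ i, f (σ i) x - N * h x| then ∏ i, p (σ i) else 0)
      ≤ 2 * Real.exp (-(N * δ ^ 2 / 4)) := by
    intro x
    have h1 := sum_prod_ite_le_exp p (fun a => f a x) hp hp1 (fun a => hf a x) N hδ0 hδ
    have h2 := sum_prod_ite_le_exp p (fun a => -f a x) hp hp1
      (fun a => by rw [abs_neg]; exact hf a x) N hδ0 hδ
    simp only [mul_neg, sum_neg_distrib, hh] at h1 h2
    rw [two_mul]
    refine le_trans ?_ (add_le_add h1 h2)
    rw [← sum_add_distrib]
    refine sum_le_sum fun σ _ => ?_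
    have hσ := hw σ
    split_ifs with h3 h4 h5 h5 h4 h5 h5 <;> try linarith
    exfalso
    rcases le_abs.mp h3 with h | h <;> linarith
  have hsum : ∑ σ : Fin N → α, (∏ i, p (σ i)) * (#{x | N * δ ≤ |∑ i, f (σ i) x - N * h x|} : ℝ)
      ≤ B := by
    have : ∀ σ : Fin N → α,
        (∏ i, p (σ i)) * (#{x | N * δ ≤ |∑ i, f (σ i) x - N * h x|} : ℝ)
        = ∑ x, if N * δ ≤ |∑ i, f (σ i) x - N * h x| then ∏ i, p (σ i) else 0 := by
      intro σ
      rw [card_filter]; push_cast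
      rw [mul_sum]
      exact sum_congr rfl fun x _ => by split_ifs <;> simp
    simp only [this]
    rw [sum_comm]
    refine (sum_le_sum fun x _ => htwo x).trans ?_
    rw [sum_const, card_univ, nsmul_eq_mul, hB, mul_comm]
  by_contra! hcon
  have h0 : ∑ σ : Fin N → α,
      (∏ i, p (σ i)) * ((#{x | N * δ ≤ |∑ i, f (σ i) x - N * h x|} : ℝ) - B) ≤ 0 := by
    simp only [mul_sub, sum_sub_distrib, ← sum_mul, hw1]
    linarith
  have hnn : ∀ σ ∈ (univ : Finset (Fin N → α)),
      0 ≤ (∏ i, p (σ i)) * ((#{x | N * δ ≤ |∑ i, f (σ i) x - N * h x|} : ℝ) - B) :=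
    fun σ _ => mul_nonneg (hw σ) (sub_nonneg.mpr (hcon σ).le)
  have hz := (sum_eq_zero_iff_of_nonneg hnn).mp (le_antisymm h0 (sum_nonneg hnn))
  have : ∑ σ : Fin N → α, ∏ i, p (σ i) = 0 := by
    refine sum_eq_zero fun σ hσ => ?_
    exact (mul_eq_zero.mp (hz σ hσ)).resolve_right (sub_pos.mpr (hcon σ)).ne'
  rw [hw1] at this
  exact one_ne_zero this

end Approx

/-- A function whose Fourier coefficients are supported on `U` with spectral norm at most `A` is
pointwise close, outside a small set, to `A / N` times a sum of `N` signed characters of `U`. -/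
lemma exists_signed_characters_approx (U : Submodule (ZMod 2) (Cube n)) [Fintype U]
    (h : Cube n → ℝ) (hU : fourierSupport h ⊆ U) {A : ℝ} (hA : ∑ S, |cubeFourierCoeff h S| ≤ A)
    (hA1 : 1 ≤ A) (N : ℕ) :
    ∃ σ : Fin N → U × Bool,
      (#{x | N / (2 * A) ≤ |∑ i, (if (σ i).2 then 1 else -1) * character (σ i).1 x
        - N * (h x / A)|} : ℝ) ≤ 2 * Real.exp (-(N / (16 * A ^ 2))) * 2 ^ n := by
  classical
  have hA0 : (0 : ℝ) < A := by linarith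
  have hsum : ∀ g : Cube n → ℝ, (∀ S, cubeFourierCoeff h S = 0 → g S = 0) →
      ∑ S : U, g S = ∑ S, g S := by
    intro g hg
    rw [← sum_subtype {S | S ∈ U} (by simp) g]
    refine sum_subset (subset_univ _) fun S _ hS => hg S ?_
    by_contra h0
    exact hS (by simpa using hU h0)
  set b : Cube n → ℝ := fun S => cubeFourierCoeff h S / A with hb
  -- The mass missing from `∑ |b S| ≤ 1` goes to `S = 0`, split evenly between the signs so that the
  -- mean is unchanged.
  set q : U → ℝ := fun S => |b S| + if S = 0 then 1 - ∑ S, |b S| else 0 with hq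
  have hbsum : ∑ S, |b S| ≤ 1 := by
    simp only [hb, abs_div, abs_of_pos hA0, ← sum_div]
    exact div_le_one_of_le₀ hA hA0.le
  have hbU : ∑ S : U, |b S| = ∑ S, |b S| := hsum (fun S => |b S|) fun S hS => by simp [hb, hS]
  obtain ⟨σ, hσ⟩ := exists_card_approx_le (α := U × Bool)
    (fun a => (q a.1 + (if a.2 then 1 else -1) * b a.1) / 2)
    (fun a x => (if a.2 then 1 else -1) * character (a.1 : Cube n) x) (fun x => h x / A)
    (by
      rintro ⟨S, s⟩
      have h1 := neg_abs_le (b S)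
      have h2 := le_abs_self (b S)
      have h3 : |b S| ≤ q S := by
        simp only [hq]
        split_ifs <;> linarith
      cases s <;> simp <;> linarith)
    (by
      simp only [Fintype.sum_prod_type, Fintype.sum_bool]
      simp only [Bool.false_eq_true, if_true, if_false]
      have : ∀ S : U, (q S + 1 * b S) / 2 + (q S + -1 * b S) / 2 = q S := fun S => by ring
      simp only [this]
      simp only [hq, sum_add_distrib, hbU]
      simp)
    (by
      rintro ⟨S, s⟩ x
      cases s <;> simp)
    (by
      intro x
      simp only [Fintype.sum_prod_type, Fintype.sum_bool]
      simp only [Bool.false_eq_true, if_true, if_false]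
      have : ∀ S : U, (q S + 1 * b S) / 2 * (1 * character (S : Cube n) x)
          + (q S + -1 * b S) / 2 * (-1 * character (S : Cube n) x)
          = b S * character (S : Cube n) x := fun S => by ring
      simp only [this]
      rw [hsum (fun S => b S * character S x) fun S hS => by simp [hb, hS]]
      simp only [hb, div_mul_eq_mul_div, ← sum_div, sum_cubeFourierCoeff_mul_character])
    -- After rescaling by `A`, this tolerance is an error of `1/2` in `h`.
    N (δ := 1 / (2 * A)) (by positivity) (by
      rw [div_le_iff₀ (by positivity)]; linarith)
  refine ⟨σ, ?_⟩
  convert hσ using 4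
  · rw [mul_one_div]
  · field_simp; ring
  · simp

end

section

variable {n : ℕ}

/-! ### Counting Fourier-sparse Boolean functions near a given one -/

/-- The number of points where two Boolean functions differ. -/
def disagreement (c c' : BoolFun n) : ℕ := #{x | c x ≠ c' x}

lemma fourierSupport_sub_subset (f g : Cube n → ℝ) :
    fourierSupport (f - g) ⊆ fourierSupport f ∪ fourierSupport g := by
  intro S hS
  by_contra h
  simp only [fourierSupport, Set.mem_union, Set.mem_ofPred_eq, not_or, not_not] at h
  apply hS
  have : cubeFourierCoeff (f - g) S = cubeFourierCoeff f S - cubeFourierCoeff g S := by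
    simp only [cubeFourierCoeff, Pi.sub_apply, sub_mul, sum_sub_distrib, sub_div]
  rw [this, h.1, h.2, sub_self]

lemma ncard_fourierSupport_sub_le {c c' : BoolFun n} {k : ℕ} (hc : c ∈ sparseClass n k)
    (hc' : c' ∈ sparseClass n k) :
    (fourierSupport (c.toReal - c'.toReal)).ncard ≤ 2 * k := by
  refine (Set.ncard_le_ncard (fourierSupport_sub_subset _ _)).trans
    ((Set.ncard_union_le _ _).trans ?_)
  rw [two_mul]
  exact add_le_add hc hc'

lemma BoolFun.toReal_sub_ne_zero_iff (c c' : BoolFun n) (x : Cube n) :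
    (c.toReal - c'.toReal) x ≠ 0 ↔ c x ≠ c' x := by
  rcases Int.units_eq_one_or (c x) with h | h <;> rcases Int.units_eq_one_or (c' x) with h' | h' <;>
    norm_num [BoolFun.toReal, h, h']

/-- Distinct Fourier-sparse Boolean functions are far apart. -/
lemma two_pow_le_disagreement_mul {c c' : BoolFun n} {k : ℕ} (hc : c ∈ sparseClass n k)
    (hc' : c' ∈ sparseClass n k) (hne : c' ≠ c) : 2 ^ n ≤ disagreement c c' * (2 * k) := by
  classical
  have h := two_pow_le_card_ne_zero_mul_of_fourierSupport (c.toReal - c'.toReal)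
    (fourierSupport (c.toReal - c'.toReal)).toFinset (by simp)
    (fun h => hne (BoolFun.toReal_injective (sub_eq_zero.mp h)).symm)
  rw [← Set.ncard_eq_toFinset_card'] at h
  simp only [BoolFun.toReal_sub_ne_zero_iff] at h
  exact h.trans (Nat.mul_le_mul_left _ (ncard_fourierSupport_sub_le hc hc'))

/-- `(c - c')/2` takes values in `{0, ±1}`, so Parseval gives its square mass as the fraction of
disagreements; Cauchy–Schwarz applies over at most `2k` frequencies. -/
lemma sum_abs_cubeFourierCoeff_half_sub_le {c c' : BoolFun n} {k : ℕ} (hc : c ∈ sparseClass n k)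
    (hc' : c' ∈ sparseClass n k) :
    (∑ S, |cubeFourierCoeff (fun x => (c.toReal x - c'.toReal x) / 2) S|) ^ 2
      ≤ 2 * k * (disagreement c c' / 2 ^ n) := by
  classical
  set h : Cube n → ℝ := fun x => (c.toReal x - c'.toReal x) / 2 with hh
  set F : Finset (Cube n) := {S | cubeFourierCoeff h S ≠ 0} with hF
  have hcoef : ∀ S, cubeFourierCoeff h S = cubeFourierCoeff (c.toReal - c'.toReal) S / 2 := by
    intro S
    simp only [cubeFourierCoeff, hh, Pi.sub_apply, div_mul_eq_mul_div, ← sum_div]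
    ring
  have hFcard : #F ≤ 2 * k := by
    refine le_trans ?_ (ncard_fourierSupport_sub_le hc hc')
    rw [← Set.ncard_coe_finset]
    refine Set.ncard_le_ncard fun S hS => ?_
    simp only [hF, coe_filter, mem_univ, true_and, Set.mem_ofPred_eq, hcoef] at hS
    intro h0
    exact hS (by rw [h0, zero_div])
  have hsupp : ∀ g : Cube n → ℝ, (∀ S, cubeFourierCoeff h S = 0 → g S = 0) →
      ∑ S, g S = ∑ S ∈ F, g S := by
    intro g hg
    refine (sum_subset (subset_univ F) fun S _ hS => hg S ?_).symm
    by_contra h0; exact hS (by simp [hF, h0])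
  have hpars : ∑ S, cubeFourierCoeff h S ^ 2 = disagreement c c' / 2 ^ n := by
    rw [eq_div_iff (by positivity), mul_comm, sum_sq_cubeFourierCoeff, disagreement, card_filter]
    push_cast
    refine sum_congr rfl fun x _ => ?_
    rcases Int.units_eq_one_or (c x) with h1 | h1 <;>
      rcases Int.units_eq_one_or (c' x) with h2 | h2 <;>
      norm_num [hh, BoolFun.toReal, h1, h2]
  rw [hsupp _ fun S hS => by simp [hS]]
  refine sq_sum_le_card_mul_sum_sq.trans ?_
  simp only [sq_abs]
  rw [← hsupp (fun S => cubeFourierCoeff h S ^ 2) fun S hS => by simp [hS], hpars]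
  have : (#F : ℝ) ≤ 2 * k := by exact_mod_cast hFcard
  gcongr

/-- Sparse functions spectrally supported on `U` and close to `c` are determined by few characters
of `U`. -/
lemma card_le_of_code_length {c : BoolFun n} {k : ℕ} (hk : 0 < k) (hc : c ∈ sparseClass n k)
    (U : Submodule (ZMod 2) (Cube n)) (hcU : fourierSupport c.toReal ⊆ U) (N : ℕ)
    (B : Finset (BoolFun n)) (hB : ∀ c' ∈ B, c' ∈ sparseClass n k ∧ c' ≠ c ∧
      fourierSupport c'.toReal ⊆ U ∧
      16 * Real.log (16 * k) * (2 * k * (disagreement c c' / 2 ^ n)) ≤ N) :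
    #B ≤ (2 * 2 ^ Module.finrank (ZMod 2) U) ^ N := by
  classical
  have : Fintype U := Fintype.ofFinite U
  rcases B.eq_empty_or_nonempty with rfl | ⟨c₀, hc₀⟩
  · simp
  set M : ℝ := 16 * Real.log (16 * k) with hM
  have hk1 : (1 : ℝ) ≤ k := by exact_mod_cast hk
  have hMpos : 0 < M := mul_pos (by norm_num) (Real.log_pos (by linarith))
  have hd1 : ∀ c' ∈ B, 1 ≤ 2 * k * ((disagreement c c' : ℝ) / 2 ^ n) := by
    intro c' hc'
    obtain ⟨h1, h2, -, -⟩ := hB c' hc'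
    have h := two_pow_le_disagreement_mul hc h1 h2
    rw [← mul_div_assoc, one_le_div (by positivity), mul_comm]
    exact_mod_cast h
  set A : ℝ := √(N / M) with hA
  have hNM : ∀ c' ∈ B, 2 * k * ((disagreement c c' : ℝ) / 2 ^ n) ≤ N / M := by
    intro c' hc'
    rw [le_div_iff₀ hMpos, mul_comm]
    exact (hB c' hc').2.2.2
  have hA1 : 1 ≤ A := Real.one_le_sqrt.mpr ((hd1 _ hc₀).trans (hNM _ hc₀))
  have hA0 : 0 < A := by linarith
  have hA2 : A ^ 2 = N / M := Real.sq_sqrt (by positivity)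
  have hNpos : (0 : ℝ) < N := by
    by_contra h
    have h0 : (N : ℝ) = 0 := le_antisymm (not_lt.mp h) (Nat.cast_nonneg N)
    rw [h0, zero_div] at hA2
    nlinarith
  -- The choice `A² = N / M` makes each exceptional set at most a fraction `1/(8k)`; two of them
  -- cannot cover the `1/(2k)` on which distinct sparse functions differ.
  have hexp : 2 * Real.exp (-(N / (16 * A ^ 2))) = 1 / (8 * k) := by
    have : (N : ℝ) / (16 * A ^ 2) = Real.log (16 * k) := by
      rw [hA2, hM]
      have : Real.log (16 * k) ≠ 0 := (Real.log_pos (by linarith)).ne'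
      field_simp
    rw [this, Real.exp_neg, Real.exp_log (by positivity)]
    field_simp; norm_num
  have hcode : ∀ c' ∈ B, ∃ σ : Fin N → U × Bool,
      (#{x | N / (2 * A) ≤ |∑ i, (if (σ i).2 then 1 else -1) * character (σ i).1 x
        - N * ((c.toReal x - c'.toReal x) / 2 / A)|} : ℝ) ≤ 1 / (8 * k) * 2 ^ n := by
    intro c' hc'
    obtain ⟨h1, h2, h3, -⟩ := hB c' hc'
    rw [← hexp]
    refine exists_signed_characters_approx U (fun x => (c.toReal x - c'.toReal x) / 2) ?_ ?_ hA1 N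
    · intro S hS
      by_contra hSU
      apply hS
      have e1 : cubeFourierCoeff c.toReal S = 0 := by
        by_contra h0; exact hSU (hcU h0)
      have e2 : cubeFourierCoeff c'.toReal S = 0 := by
        by_contra h0; exact hSU (h3 h0)
      have : cubeFourierCoeff (fun x => (c.toReal x - c'.toReal x) / 2) S
          = (cubeFourierCoeff c.toReal S - cubeFourierCoeff c'.toReal S) / 2 := by
        simp only [cubeFourierCoeff, div_mul_eq_mul_div, sub_mul, ← sum_div, sum_sub_distrib]
        ring
      rw [this, e1, e2]; simp
    · refine Real.le_sqrt_of_sq_le ?_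
      exact (sum_abs_cubeFourierCoeff_half_sub_le hc h1).trans (hNM c' hc')
  choose! code hcode using hcode
  have hinj : Set.InjOn code B := by
    intro c₁ h₁ c₂ h₂ heq
    by_contra hne
    obtain ⟨hs1, -, -, -⟩ := hB c₁ h₁
    obtain ⟨hs2, -, -, -⟩ := hB c₂ h₂
    have hfar := two_pow_le_disagreement_mul hs2 hs1 hne
    have b1 := hcode c₁ h₁
    have b2 := hcode c₂ h₂
    rw [← heq] at b2
    set σ := code c₁
    -- Where the common code is within `1/2` of both functions, `|c₁ - c₂| / 2 < 1`, so `c₁` and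
    -- `c₂` agree.
    have hsub : ({x | c₂ x ≠ c₁ x} : Finset (Cube n)) ⊆
        ({x | N / (2 * A) ≤ |∑ i, (if (σ i).2 then 1 else -1) * character (σ i).1 x
          - N * ((c.toReal x - c₁.toReal x) / 2 / A)|} : Finset (Cube n)) ∪
        ({x | N / (2 * A) ≤ |∑ i, (if (σ i).2 then 1 else -1) * character (σ i).1 x
          - N * ((c.toReal x - c₂.toReal x) / 2 / A)|} : Finset (Cube n)) := by
      intro x hx
      simp only [mem_filter, mem_univ, true_and, mem_union] at hx ⊢
      by_contra! hcon
      obtain ⟨l1, l2⟩ := hcon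
      set Z := ∑ i, (if (σ i).2 then (1 : ℝ) else -1) * character (σ i).1 x
      rw [abs_lt] at l1 l2
      have e : N * ((c₁.toReal x - c₂.toReal x) / 2 / A)
          = (Z - N * ((c.toReal x - c₁.toReal x) / 2 / A))
            - (Z - N * ((c.toReal x - c₂.toReal x) / 2 / A)) := by ring
      have hq : |N * ((c₁.toReal x - c₂.toReal x) / 2 / A)| < N / A := by
        have e2 : N / A = N / (2 * A) + N / (2 * A) := by field_simp; norm_num
        rw [e, e2, abs_lt]
        constructor <;> linarith
      have hq2 : |N * ((c₁.toReal x - c₂.toReal x) / 2 / A)| = N / A := by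
        have : |c₁.toReal x - c₂.toReal x| = 2 := by
          rcases Int.units_eq_one_or (c₁ x) with h1 | h1 <;>
          rcases Int.units_eq_one_or (c₂ x) with h2 | h2 <;>
            first
            | exact absurd (h1.trans h2.symm) hx.symm
            | norm_num [BoolFun.toReal, h1, h2]
        rw [abs_mul, abs_div, abs_div, this, abs_of_pos hA0, abs_of_pos hNpos]
        norm_num
        rw [div_eq_mul_inv]
      exact hq.ne hq2
    have hcard : (disagreement c₂ c₁ : ℝ) ≤ 1 / (8 * k) * 2 ^ n + 1 / (8 * k) * 2 ^ n := by
      refine le_trans ?_ (add_le_add b1 b2)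
      exact_mod_cast (card_le_card hsub).trans (card_union_le _ _)
    have hfar' : (2 : ℝ) ^ n ≤ disagreement c₂ c₁ * (2 * k) := by exact_mod_cast hfar
    have : (2 : ℝ) ^ n ≤ (1 / (8 * k) * 2 ^ n + 1 / (8 * k) * 2 ^ n) * (2 * k) :=
      hfar'.trans (mul_le_mul_of_nonneg_right hcard (by positivity))
    have e3 : (1 / (8 * k) * 2 ^ n + 1 / (8 * k) * 2 ^ n) * (2 * k) = (2 : ℝ) ^ n / 2 := by
      field_simp; norm_num
    have h2n : (0 : ℝ) < 2 ^ n := by positivity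
    linarith
  calc #B = #(B.image code) := (card_image_of_injOn hinj).symm
    _ ≤ Fintype.card (Fin N → U × Bool) := card_le_univ _
    _ = _ := by
      rw [Fintype.card_fun, Fintype.card_prod, Fintype.card_bool, Fintype.card_fin, mul_comm,
        Module.card_eq_pow_finrank (K := ZMod 2) (V := U), ZMod.card]

/-- The expected number of wrong sparse hypotheses with spectrum in `U` that survive `T` random
tests, each of which detects a disagreement at a uniform point with probability one half. -/
theorem sum_survival_le {c : BoolFun n} {k : ℕ} (hk : 0 < k) (hc : c ∈ sparseClass n k)
    (U : Submodule (ZMod 2) (Cube n)) (hcU : fourierSupport c.toReal ⊆ U)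
    (B : Finset (BoolFun n)) (hB : ∀ c' ∈ B, c' ∈ sparseClass n k ∧ c' ≠ c ∧
      fourierSupport c'.toReal ⊆ U) {T : ℕ}
    (hT : 384 * Real.log (16 * k) * k * (Module.finrank (ZMod 2) U + 1) ≤ T) :
    ∑ c' ∈ B, (1 - disagreement c c' / 2 ^ n / 2 : ℝ) ^ T ≤ 1 / 8 := by
  classical
  set r := Module.finrank (ZMod 2) U with hr
  set M : ℝ := 16 * Real.log (16 * k) with hM
  have hk1 : (1 : ℝ) ≤ k := by exact_mod_cast hk
  have hM1 : 1 ≤ M := by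
    have h1 : Real.log 3 ≤ Real.log (16 * k) := Real.log_le_log (by norm_num) (by linarith)
    have h2 : 1 ≤ Real.log 3 := by
      rw [Real.le_log_iff_exp_le (by norm_num)]
      exact Real.exp_one_lt_three.le
    linarith
  set d : BoolFun n → ℝ := fun c' => disagreement c c' / 2 ^ n with hd
  set len : BoolFun n → ℕ := fun c' => ⌈M * (2 * k * d c')⌉₊ with hlen
  have hd1 : ∀ c' ∈ B, 1 ≤ 2 * k * d c' := by
    intro c' hc'
    obtain ⟨h1, h2, -⟩ := hB c' hc'
    have h := two_pow_le_disagreement_mul hc h1 h2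
    rw [hd, ← mul_div_assoc, one_le_div (by positivity), mul_comm]
    exact_mod_cast h
  have hd01 : ∀ c', d c' ≤ 1 := by
    intro c'
    rw [hd]
    refine div_le_one_of_le₀ ?_ (by positivity)
    have : disagreement c c' ≤ Fintype.card (Cube n) := card_le_univ _
    simp only [Fintype.card_pi, ZMod.card, prod_const, card_univ, Fintype.card_fin] at this
    exact_mod_cast this
  set y : ℝ := Real.exp (-(3 * (r + 1))) with hy
  -- The bound on `T` reads `T ≥ 24 M k (r + 1)`, while `len c' ≤ 4 M k d`, the ceiling costing at
  -- most a factor two as its argument is at least one.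
  have hterm : ∀ c' ∈ B, (1 - disagreement c c' / 2 ^ n / 2 : ℝ) ^ T ≤ y ^ len c' := by
    intro c' hc'
    have h1 : (1 - d c' / 2 : ℝ) ≤ Real.exp (-(d c' / 2)) := Real.one_sub_le_exp_neg _
    have h0 : 0 ≤ (1 - d c' / 2 : ℝ) := by linarith [hd01 c']
    refine (pow_le_pow_left₀ h0 h1 T).trans ?_
    rw [hy, ← Real.exp_nat_mul, ← Real.exp_nat_mul, Real.exp_le_exp]
    have hone : 1 ≤ M * (2 * k * d c') := one_le_mul_of_one_le_of_one_le hM1 (hd1 c' hc')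
    have hl : (len c' : ℝ) ≤ 2 * (M * (2 * k * d c')) := by
      have := Nat.ceil_lt_add_one (a := M * (2 * k * d c')) (by linarith)
      simp only [hlen]; linarith
    have hdn : 0 ≤ d c' := by positivity
    have h3 : (len c' : ℝ) * (3 * (r + 1)) ≤ T * (d c' / 2) := by
      calc (len c' : ℝ) * (3 * (r + 1)) ≤ 2 * (M * (2 * k * d c')) * (3 * (r + 1)) := by gcongr
        _ = (24 * M * k * (r + 1)) * (d c' / 2) := by ring
        _ = (384 * Real.log (16 * k) * k * (r + 1)) * (d c' / 2) := by rw [hM]; ring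
        _ ≤ T * (d c' / 2) := by gcongr
    linarith
  -- At most `2^((r+1)N)` hypotheses have code length `N`, and `2 exp(-3) ≤ 1/9`. Lengths start at
  -- one, so the geometric series sums to at most `1/8`.
  have hcount : ∀ N : ℕ, (#{c' ∈ B | len c' = N} : ℝ) * y ^ N ≤ (1 / 9) ^ N := by
    intro N
    have h := card_le_of_code_length hk hc U hcU N {c' ∈ B | len c' = N} (by
      intro c' hc'
      obtain ⟨hc'B, hl⟩ := mem_filter.mp hc'
      obtain ⟨h1, h2, h3⟩ := hB c' hc'B
      refine ⟨h1, h2, h3, ?_⟩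
      rw [← hl]
      exact Nat.le_ceil _)
    have h' : (#{c' ∈ B | len c' = N} : ℝ) ≤ (2 * 2 ^ r) ^ N := by exact_mod_cast h
    refine (mul_le_mul_of_nonneg_right h' (pow_nonneg (Real.exp_pos _).le N)).trans ?_
    rw [← mul_pow]
    refine pow_le_pow_left₀ (by positivity) ?_ N
    have e1 : y = Real.exp (-3) ^ (r + 1) := by
      rw [hy, ← Real.exp_nat_mul]; push_cast; ring_nf
    have e2 : (2 : ℝ) * 2 ^ r = 2 ^ (r + 1) := by ring
    change 2 * 2 ^ r * y ≤ 1 / 9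
    rw [e1, e2, ← mul_pow]
    have e3 : (2 : ℝ) * Real.exp (-3) ≤ 1 / 9 := by
      have h2 : (2.7 : ℝ) ≤ Real.exp 1 := by linarith [Real.exp_one_gt_d9]
      have h3 : Real.exp 3 = Real.exp 1 ^ 3 := by rw [← Real.exp_nat_mul]; norm_num
      have h4 : (18 : ℝ) ≤ Real.exp 3 := by
        rw [h3]
        calc (18 : ℝ) ≤ 2.7 ^ 3 := by norm_num
          _ ≤ _ := by gcongr
      rw [Real.exp_neg, ← div_eq_mul_inv, div_le_div_iff₀ (Real.exp_pos _) (by norm_num)]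
      linarith
    exact (pow_le_of_le_one (by positivity) (by linarith) (Nat.succ_ne_zero r)).trans e3
  obtain ⟨m, hm⟩ : ∃ m : ℕ, ∀ c' ∈ B, len c' ∈ Ico 1 m := by
    refine ⟨B.sup len + 1, fun c' hc' => mem_Ico.mpr ⟨?_, ?_⟩⟩
    · rw [hlen, Nat.one_le_ceil_iff]
      linarith [one_le_mul_of_one_le_of_one_le hM1 (hd1 c' hc')]
    · exact Nat.lt_succ_of_le (le_sup hc')
  calc ∑ c' ∈ B, (1 - disagreement c c' / 2 ^ n / 2 : ℝ) ^ T ≤ ∑ c' ∈ B, y ^ len c' :=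
        sum_le_sum hterm
    _ = ∑ N ∈ Ico 1 m, ∑ c' ∈ B with len c' = N, y ^ len c' :=
        (sum_fiberwise_of_maps_to hm _).symm
    _ = ∑ N ∈ Ico 1 m, (#{c' ∈ B | len c' = N} : ℝ) * y ^ N := by
        refine sum_congr rfl fun N _ => ?_
        rw [sum_congr rfl fun c' hc' => by rw [(mem_filter.mp hc').2], sum_const, nsmul_eq_mul]
    _ ≤ ∑ N ∈ Ico 1 m, (1 / 9 : ℝ) ^ N := sum_le_sum fun N _ => hcount N
    _ ≤ (1 / 9) ^ 1 / (1 - 1 / 9) := geom_sum_Ico_le_of_lt_one (by norm_num) (by norm_num)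
    _ = 1 / 8 := by norm_num

end

/-! ### Product measurements -/

section Product

variable {ι O α : Type} [Fintype ι] [DecidableEq ι] [Fintype O] [Fintype α] [DecidableEq α]

/-- The measurement of each of `T` registers by a rank-one measurement `v`, followed by classical
post-processing `g` of the outcomes. -/
noncomputable def productPOVM (v : O → ι → ℂ)
    (hv : ∀ t t', ∑ o, v o t * star (v o t') = if t = t' then 1 else 0) {T : ℕ}
    (g : (Fin T → O) → α) : POVM (Fin T → ι) α where
  effect a := ∑ s with g s = a,
    Matrix.vecMulVec (fun t => ∏ i, v (s i) (t i)) (star fun t => ∏ i, v (s i) (t i))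
  posSemidef a := Matrix.posSemidef_sum _ fun s _ => Matrix.posSemidef_vecMulVec_self_star _
  sum_eq_one := by
    rw [sum_fiberwise]
    ext t t'
    simp only [Matrix.sum_apply, Matrix.vecMulVec_apply, Pi.star_apply, star_prod,
      ← prod_mul_distrib]
    have h := prod_univ_sum (fun _ : Fin T => (univ : Finset O))
      (fun i o => v o (t i) * star (v o (t' i)))
    rw [Fintype.piFinset_univ] at h
    rw [← h]
    simp only [hv, Matrix.one_apply]
    rw [prod_ite_zero]
    simp [funext_iff]

/-- The probability of a single outcome of the measurement `v` on the state `ψ`. -/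
noncomputable def outcomeProb (v : O → ι → ℂ) (ψ : ι → ℂ) (o : O) : ℝ :=
  Complex.normSq (star (v o) ⬝ᵥ ψ)

/-- The effects are built from product vectors, so amplitudes on `ψ^{⊗T}` factor and the outcomes
are independent. -/
lemma productPOVM_prob (v : O → ι → ℂ)
    (hv : ∀ t t', ∑ o, v o t * star (v o t') = if t = t' then 1 else 0) {T : ℕ}
    (g : (Fin T → O) → α) (ψ : ι → ℂ) (a : α) :
    (productPOVM v hv g).prob (tensorPower ψ T) a
      = ∑ s with g s = a, ∏ i, outcomeProb v ψ (s i) := by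
  have hprod : ∀ s : Fin T → O, star (fun t : Fin T → ι => ∏ i, v (s i) (t i)) ⬝ᵥ tensorPower ψ T
      = ∏ i, (star (v (s i)) ⬝ᵥ ψ) := by
    intro s
    simp only [dotProduct, tensorPower, Pi.star_apply, star_prod, ← prod_mul_distrib]
    have h := prod_univ_sum (fun _ : Fin T => (univ : Finset ι))
      (fun i t => star (v (s i) t) * ψ t)
    rw [Fintype.piFinset_univ] at h
    exact h.symm
  simp only [POVM.prob, productPOVM, Matrix.sum_mulVec, dotProduct_sum, Complex.re_sum]
  refine sum_congr rfl fun s _ => ?_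
  rw [Matrix.vecMulVec_mulVec, dotProduct_smul, hprod]
  have h2 : star (tensorPower ψ T) ⬝ᵥ (fun t : Fin T → ι => ∏ i, v (s i) (t i))
      = star (∏ i, (star (v (s i)) ⬝ᵥ ψ)) := by
    rw [← hprod, Matrix.star_dotProduct]
  rw [h2]
  simp only [outcomeProb, ← map_prod]
  rw [op_smul_eq_mul, RCLike.star_def, ← Complex.normSq_eq_conj_mul_self]
  exact Complex.ofReal_re _

end Product

section

variable {n : ℕ}

/-! ### Sampling from the example or from its Fourier spectrum -/

/-- A fair mixture of the computational basis and the Fourier basis of one example register; the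
Fourier outcome `(S, -1)` is the one with the amplitude of `c` at the character `S`. -/
noncomputable def sampleVec : ExampleBasis n ⊕ ExampleBasis n → ExampleBasis n → ℝ
  | .inl q, p => if p = q then 1 / √2 else 0
  | .inr q, p => 1 / (2 * √(2 ^ n)) * (character q.1 p.1 * if q.2 = 1 then 1 else ((p.2 : ℤ) : ℝ))

lemma sum_intUnits (f : ℤˣ → ℝ) : ∑ s, f s = f 1 + f (-1) := by
  rw [show (univ : Finset ℤˣ) = {1, -1} from rfl, sum_pair (by decide)]

/-- Each of the two orthonormal bases, scaled by `1/√2`, contributes half of the identity. -/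
lemma sum_sampleVec_mul (t t' : ExampleBasis n) :
    ∑ o, sampleVec o t * sampleVec o t' = if t = t' then 1 else 0 := by
  have h2n : (0 : ℝ) < 2 ^ n := by positivity
  have hs : √(2 ^ n : ℝ) * √(2 ^ n) = 2 ^ n := Real.mul_self_sqrt h2n.le
  rw [Fintype.sum_sum_type]
  have h1 : ∑ q : ExampleBasis n, sampleVec (.inl q) t * sampleVec (.inl q) t'
      = if t = t' then 1 / 2 else 0 := by
    have hsq : (1 / √2 : ℝ) * (1 / √2) = 1 / 2 := by
      rw [div_mul_div_comm, Real.mul_self_sqrt (by norm_num)]; norm_num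
    simp only [sampleVec, ite_mul, zero_mul, mul_ite, mul_zero, hsq]
    simp
  have h2 : ∑ q : ExampleBasis n, sampleVec (.inr q) t * sampleVec (.inr q) t'
      = if t = t' then 1 / 2 else 0 := by
    have e : ∀ S : Cube n, sampleVec (.inr (S, 1)) t * sampleVec (.inr (S, 1)) t'
        + sampleVec (.inr (S, -1)) t * sampleVec (.inr (S, -1)) t'
        = (1 + ((t.2 : ℤ) : ℝ) * ((t'.2 : ℤ) : ℝ)) / (4 * 2 ^ n)
          * (character t.1 S * character t'.1 S) := by
      intro S
      have hne : (-1 : ℤˣ) ≠ 1 := by decide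
      have hc : (1 / (2 * √(2 ^ n : ℝ))) * (1 / (2 * √(2 ^ n))) = 1 / (4 * 2 ^ n) := by
        rw [div_mul_div_comm, mul_mul_mul_comm, hs]; norm_num
      simp only [sampleVec, if_true, if_neg hne, character_comm S]
      linear_combination (1 + ((t.2 : ℤ) : ℝ) * ((t'.2 : ℤ) : ℝ))
        * (character t.1 S * character t'.1 S) * hc
    rw [Fintype.sum_prod_type]
    simp only [sum_intUnits, e, ← mul_sum, sum_character_mul]
    obtain ⟨x, b⟩ := t
    obtain ⟨x', b'⟩ := t'
    by_cases hx : x = x'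
    · rcases Int.units_eq_one_or b with rfl | rfl <;>
        rcases Int.units_eq_one_or b' with rfl | rfl <;> simp [hx] <;> field_simp <;> norm_num
    · simp [hx]
  rw [h1, h2]
  split_ifs <;> norm_num

/-- `sampleVec` as complex vectors. -/
noncomputable def sampleVecC (o : ExampleBasis n ⊕ ExampleBasis n) (p : ExampleBasis n) : ℂ :=
  (sampleVec o p : ℂ)

lemma sum_sampleVecC_mul (t t' : ExampleBasis n) :
    ∑ o, sampleVecC o t * star (sampleVecC o t') = if t = t' then 1 else 0 := by
  have h := sum_sampleVec_mul t t'
  have h' := congrArg (fun r : ℝ => (r : ℂ)) h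
  simp only [Complex.ofReal_sum, Complex.ofReal_mul] at h'
  simp only [sampleVecC, RCLike.star_def, Complex.conj_ofReal]
  rw [h']
  split_ifs <;> simp

/-- The outcome distribution of the sampling measurement on the example for `c`. -/
noncomputable def sampleProb (c : BoolFun n) : ExampleBasis n ⊕ ExampleBasis n → ℝ :=
  outcomeProb sampleVecC (quantumExample c)

lemma sampleProb_nonneg (c : BoolFun n) (o) : 0 ≤ sampleProb c o := Complex.normSq_nonneg _

lemma sampleProb_eq (c : BoolFun n) (o) :
    sampleProb c o = (∑ x, sampleVec o (x, c x)) ^ 2 / 2 ^ n := by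
  have h : star (sampleVecC o) ⬝ᵥ quantumExample c
      = ((∑ x, sampleVec o (x, c x)) * (1 / √(2 ^ n)) : ℝ) := by
    simp only [dotProduct, quantumExample, Fintype.sum_prod_type, mul_ite, mul_zero,
      sum_ite_eq', mem_univ, if_true, Pi.star_apply, sampleVecC, RCLike.star_def,
      Complex.conj_ofReal, sum_mul]
    push_cast
    simp
  rw [sampleProb, outcomeProb, h, Complex.normSq_ofReal, ← sq, mul_pow, div_pow, one_pow,
    Real.sq_sqrt (by positivity), mul_one_div]

lemma sampleProb_inl (c : BoolFun n) (x : Cube n) (b : ℤˣ) :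
    sampleProb c (.inl (x, b)) = if b = c x then 1 / 2 / 2 ^ n else 0 := by
  rw [sampleProb_eq]
  have : ∑ y, sampleVec (.inl (x, b)) (y, c y) = if b = c x then 1 / √2 else 0 := by
    rw [sum_eq_single x (fun y _ hy => by simp [sampleVec, hy]) (by simp)]
    simp [sampleVec, eq_comm]
  rw [this]
  split_ifs
  · rw [div_pow, Real.sq_sqrt (by norm_num), one_pow]
  · simp

lemma sampleProb_inr_neg_one (c : BoolFun n) (S : Cube n) :
    sampleProb c (.inr (S, -1)) = cubeFourierCoeff c.toReal S ^ 2 / 4 := by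
  rw [sampleProb_eq]
  have hne : (-1 : ℤˣ) ≠ 1 := by decide
  have : ∑ y, sampleVec (.inr (S, -1)) (y, c y)
      = 1 / (2 * √(2 ^ n)) * (∑ x, c.toReal x * character S x) := by
    simp only [sampleVec, if_neg hne, ← mul_sum]
    congr 1
    exact sum_congr rfl fun x _ => mul_comm _ _
  rw [this, cubeFourierCoeff, mul_pow, div_pow, div_pow, mul_pow, Real.sq_sqrt (by positivity)]
  field_simp
  ring

lemma sampleProb_inr_one (c : BoolFun n) (S : Cube n) :
    sampleProb c (.inr (S, 1)) = if S = 0 then 1 / 4 else 0 := by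
  rw [sampleProb_eq]
  have : ∑ y, sampleVec (.inr (S, 1)) (y, c y)
      = 1 / (2 * √(2 ^ n)) * if S = 0 then 2 ^ n else 0 := by
    simp only [sampleVec, if_true, mul_one, ← mul_sum, sum_character]
  rw [this]
  split_ifs
  · rw [mul_pow, div_pow, mul_pow, Real.sq_sqrt (by positivity)]
    field_simp
    norm_num
  · simp

lemma sum_sampleProb_inl (c c' : BoolFun n) :
    ∑ q : ExampleBasis n, (if q.2 = c' q.1 then sampleProb c (.inl q) else 0)
      = (1 - disagreement c c' / 2 ^ n) / 2 := by
  have h : ∀ x, ∑ b, (if b = c' x then sampleProb c (.inl (x, b)) else 0)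
      = 1 / 2 / 2 ^ n * (1 - if c x ≠ c' x then 1 else 0) := by
    intro x
    simp only [sum_ite_eq', mem_univ, if_true, sampleProb_inl]
    by_cases h : c x = c' x
    · simp [h]
    · simp [h, Ne.symm h]
  rw [Fintype.sum_prod_type]
  simp only [h, ← mul_sum, sum_sub_distrib]
  rw [disagreement, card_filter]
  push_cast
  simp only [sum_const, card_univ, Fintype.card_pi, ZMod.card, prod_const, Fintype.card_fin,
    nsmul_eq_mul]
  push_cast
  field_simp

lemma sum_sampleProb_inl_self (c : BoolFun n) :
    ∑ q : ExampleBasis n, sampleProb c (.inl q) = 1 / 2 := by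
  have h := sum_sampleProb_inl c c
  simp only [disagreement, ne_eq, not_true_eq_false, filter_false, card_empty, Nat.cast_zero,
    zero_div, sub_zero] at h
  rw [← h]
  refine sum_congr rfl fun q _ => ?_
  obtain ⟨x, b⟩ := q
  split_ifs with hb
  · rfl
  · rw [sampleProb_inl, if_neg hb]

lemma sum_sampleProb_inr (c : BoolFun n) :
    ∑ q : ExampleBasis n, sampleProb c (.inr q) = 1 / 2 := by
  rw [Fintype.sum_prod_type]
  simp only [sum_intUnits, sampleProb_inr_one, sampleProb_inr_neg_one, sum_add_distrib, ← sum_div,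
    c.sum_sq_cubeFourierCoeff]
  simp; norm_num

lemma sum_sampleProb (c : BoolFun n) : ∑ o, sampleProb c o = 1 := by
  rw [Fintype.sum_sum_type, sum_sampleProb_inl_self, sum_sampleProb_inr]; norm_num

/-- A Fourier-sparse function has Fourier weight at least `1/k` outside any subspace that does not
contain its support. -/
lemma one_div_le_fourier_weight {c : BoolFun n} {k : ℕ} (hk : 0 < k) (hc : c ∈ sparseClass n k)
    (w : Cube n) (hw : ∃ S, cubeFourierCoeff c.toReal S ≠ 0 ∧ S ⬝ᵥ w ≠ 0) :
    1 / (k : ℝ) ≤ ∑ S, if S ⬝ᵥ w = 0 then 0 else cubeFourierCoeff c.toReal S ^ 2 := by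
  classical
  -- These are the coefficients of `c x - c (x + w)`, which takes values in `{0, ±2}` and, by
  -- uncertainty, is nonzero on a fraction at least `1/k`; Parseval converts this into Fourier
  -- weight.
  set a : Cube n → ℝ := fun S => cubeFourierCoeff c.toReal S * (1 - character S w) with ha
  have hval : ∀ x, ∑ S, a S * character S x = c.toReal x - c.toReal (x + w) := by
    intro x
    rw [← sum_cubeFourierCoeff_mul_character c.toReal x,
      ← sum_cubeFourierCoeff_mul_character c.toReal (x + w), ← sum_sub_distrib]
    refine sum_congr rfl fun S _ => ?_
    rw [character_add_right, ha]; ring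
  have hunc := two_pow_le_card_ne_zero_mul a (fourierSupport c.toReal).toFinset
    (fun S hS => by
      rw [Set.mem_toFinset]
      intro h0; exact hS (by simp [ha, h0]))
    (by
      obtain ⟨S, hS, hSw⟩ := hw
      refine ⟨S, mul_ne_zero hS ?_⟩
      rw [character_of_dotProduct_ne_zero hSw]; norm_num)
  rw [← Set.ncard_eq_toFinset_card'] at hunc
  have hunc' := hunc.trans (Nat.mul_le_mul_left _ hc)
  have hpars := sum_sq_sum_character a
  have e1 : ∑ x : Cube n, (∑ S, a S * character S x) ^ 2
      = 4 * (#{x : Cube n | ∑ S, a S * character S x ≠ 0} : ℝ) := by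
    rw [card_filter]; push_cast
    rw [mul_sum]
    refine sum_congr rfl fun x _ => ?_
    rw [hval]
    rcases c.toReal_eq_or x with h | h <;> rcases c.toReal_eq_or (x + w) with h' | h' <;>
      norm_num [h, h']
  have e2 : ∑ S, a S ^ 2
      = 4 * ∑ S, if S ⬝ᵥ w = 0 then 0 else cubeFourierCoeff c.toReal S ^ 2 := by
    rw [mul_sum]
    refine sum_congr rfl fun S _ => ?_
    split_ifs with h
    · simp [ha, character, h]
    · rw [ha]; simp only [character_of_dotProduct_ne_zero h]; ring
  rw [e1, e2] at hpars
  have h3 : (2 : ℝ) ^ n ≤ #{x : Cube n | ∑ S, a S * character S x ≠ 0} * k := by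
    exact_mod_cast hunc'
  have hk' : (0 : ℝ) < k := by exact_mod_cast hk
  rw [div_le_iff₀ hk']
  have h2n : (0 : ℝ) < 2 ^ n := by positivity
  refine le_of_mul_le_mul_left ?_ h2n
  nlinarith

/-- A sample detects `w` with a quarter of the weight in `one_div_le_fourier_weight`: one half for
the basis, one half for the outcome `-1` in the last register. -/
lemma sum_sampleProb_le_of_fourier {c : BoolFun n} {k : ℕ} (hk : 0 < k) (hc : c ∈ sparseClass n k)
    (w : Cube n) (hw : ∃ S, cubeFourierCoeff c.toReal S ≠ 0 ∧ S ⬝ᵥ w ≠ 0) :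
    ∑ o, (if ∀ S, o = .inr (S, -1) → S ⬝ᵥ w = 0 then sampleProb c o else 0)
      ≤ 1 - 1 / (4 * k) := by
  classical
  have hone := sum_sampleProb c
  have h := one_div_le_fourier_weight hk hc w hw
  have hcompl : ∑ o, (if ∀ S, o = .inr (S, -1) → S ⬝ᵥ w = 0 then 0 else sampleProb c o)
      = (∑ S, if S ⬝ᵥ w = 0 then 0 else cubeFourierCoeff c.toReal S ^ 2) / 4 := by
    rw [Fintype.sum_sum_type, Fintype.sum_prod_type, Fintype.sum_prod_type, sum_div]
    simp only [sum_intUnits, reduceCtorEq, false_imp_iff, implies_true, if_true,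
      sum_const_zero, zero_add]
    refine sum_congr rfl fun S _ => ?_
    have e1 : ∀ S', (Sum.inr (S, 1) : ExampleBasis n ⊕ ExampleBasis n) = .inr (S', -1)
        → S' ⬝ᵥ w = 0 := by
      intro S' h
      simp only [Sum.inr.injEq, Prod.mk.injEq] at h
      exact absurd h.2 (by decide)
    have e2 : (∀ S', (Sum.inr (S, -1) : ExampleBasis n ⊕ ExampleBasis n) = .inr (S', -1)
        → S' ⬝ᵥ w = 0) ↔ S ⬝ᵥ w = 0 := by
      simp
    rw [if_pos e1, zero_add, sampleProb_inr_neg_one]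
    simp only [e2]
    split_ifs <;> simp
  have hsplit : ∑ o, sampleProb c o
      = ∑ o, (if ∀ S, o = .inr (S, -1) → S ⬝ᵥ w = 0 then sampleProb c o else 0)
        + ∑ o, (if ∀ S, o = .inr (S, -1) → S ⬝ᵥ w = 0 then 0 else sampleProb c o) := by
    rw [← sum_add_distrib]
    exact sum_congr rfl fun o _ => by split_ifs <;> simp
  have h4 : 1 / (4 * (k : ℝ)) = 1 / k / 4 := by
    rw [div_div, mul_comm]
  rw [h4]
  linarith

/-- Inconsistency needs both the computational basis, of probability one half, and a point of
disagreement. -/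
lemma sum_sampleProb_of_consistent (c c' : BoolFun n) :
    ∑ o, (if ∀ x b, o = .inl (x, b) → b = c' x then sampleProb c o else 0)
      = 1 - disagreement c c' / 2 ^ n / 2 := by
  rw [Fintype.sum_sum_type]
  have h1 := sum_sampleProb_inl c c'
  have h2 := sum_sampleProb_inr c
  have e1 : ∀ q : ExampleBasis n,
      (∀ x b, (Sum.inl q : ExampleBasis n ⊕ ExampleBasis n) = .inl (x, b) → b = c' x)
        ↔ q.2 = c' q.1 := by
    rintro ⟨x, b⟩
    simp only [Sum.inl.injEq, Prod.mk.injEq]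
    constructor
    · intro h; exact h x b ⟨rfl, rfl⟩
    · rintro h x' b' ⟨rfl, rfl⟩; exact h
  simp only [e1, reduceCtorEq, false_imp_iff, implies_true, if_true, h1, h2]
  ring

end

section

variable {n : ℕ}

/-! ### The learner -/

/-- A hypothesis fits the outcomes when its Fourier support lies in the span of the sampled
characters and it agrees with the sampled values. -/
def Fits {T : ℕ} (s : Fin T → ExampleBasis n ⊕ ExampleBasis n) (c : BoolFun n) : Prop :=
  fourierSupport c.toReal ⊆ Submodule.span (ZMod 2) {S | ∃ i, s i = .inr (S, -1)} ∧
    ∀ i x b, s i = .inl (x, b) → b = c x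

open scoped Classical in
/-- Any `k`-sparse hypothesis that fits the outcomes. -/
noncomputable def decode (k : ℕ) {T : ℕ} (s : Fin T → ExampleBasis n ⊕ ExampleBasis n) :
    BoolFun n :=
  if h : ∃ c ∈ sparseClass n k, Fits s c then h.choose else 1

lemma sum_prod_ite_forall {O : Type*} [Fintype O] (p : O → ℝ) (P : O → Prop) [DecidablePred P]
    (T : ℕ) :
    ∑ s : Fin T → O, (if ∀ i, P (s i) then ∏ i, p (s i) else 0)
      = (∑ o, if P o then p o else 0) ^ T := by
  rw [Fintype.sum_pow]
  refine sum_congr rfl fun s _ => ?_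
  rw [prod_ite_zero]
  simp

/-- The vectors of the cube realise every linear functional on a subspace. -/
lemma exists_dotProduct_eq (U : Submodule (ZMod 2) (Cube n)) (v : Module.Dual (ZMod 2) U) :
    ∃ w : Cube n, ∀ S : U, (S : Cube n) ⬝ᵥ w = v S := by
  obtain ⟨g, hg⟩ := LinearMap.exists_extend v
  refine ⟨fun i => g (Pi.single i 1), fun S => ?_⟩
  rw [← hg, LinearMap.comp_apply, Submodule.subtype_apply, LinearMap.pi_apply_eq_sum_univ g S]
  simp only [dotProduct, smul_eq_mul]
  refine sum_congr rfl fun i _ => ?_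
  congr 2
  ext j
  simp [Pi.single_apply, eq_comm]

open scoped Classical in
/-- Whenever decoding fails on a possible sequence of outcomes, the sampled characters are killed
by a functional on the Fourier span of `c`, or a wrong hypothesis fits the sampled values. -/
lemma exists_of_decode_ne {c : BoolFun n} {k : ℕ} (hc : c ∈ sparseClass n k)
    (U : Submodule (ZMod 2) (Cube n))
    (hU : U = Submodule.span (ZMod 2) (fourierSupport c.toReal))
    (w : Module.Dual (ZMod 2) U → Cube n) (hw : ∀ v (S : U), (S : Cube n) ⬝ᵥ w v = v S)
    {T : ℕ} {s : Fin T → ExampleBasis n ⊕ ExampleBasis n} (hs : decode k s ≠ c)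
    (hpos : ∏ i, sampleProb c (s i) ≠ 0) :
    (∃ v, v ≠ 0 ∧ ∀ i S, s i = .inr (S, -1) → S ⬝ᵥ w v = 0) ∨
      ∃ c', (c' ∈ sparseClass n k ∧ c' ≠ c ∧ fourierSupport c'.toReal ⊆ U) ∧
        ∀ i x b, s i = .inl (x, b) → b = c' x := by
  have hne : ∀ i, sampleProb c (s i) ≠ 0 := fun i => prod_ne_zero_iff.mp hpos i (mem_univ i)
  have hinl : ∀ i x b, s i = .inl (x, b) → b = c x := by
    intro i x b hi
    have := hne i
    rw [hi, sampleProb_inl] at this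
    by_contra h
    exact this (if_neg h)
  have hinr : ∀ i S, s i = .inr (S, -1) → S ∈ U := by
    intro i S hi
    have := hne i
    rw [hi, sampleProb_inr_neg_one] at this
    rw [hU]
    refine Submodule.subset_span fun h0 => this ?_
    rw [h0]; simp
  set V := Submodule.span (ZMod 2) {S | ∃ i, s i = .inr (S, -1)} with hV
  have hVU : V ≤ U := Submodule.span_le.mpr fun S ⟨i, hi⟩ => hinr i S hi
  by_cases hsub : fourierSupport c.toReal ⊆ V
  · right
    have hex : ∃ c ∈ sparseClass n k, Fits s c := ⟨c, hc, hsub, hinl⟩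
    have hdec : decode k s = hex.choose := dif_pos hex
    obtain ⟨h1, h2, h3⟩ := hex.choose_spec
    rw [← hdec] at h1 h2 h3
    exact ⟨decode k s, ⟨h1, hs, h2.trans hVU⟩, h3⟩
  · left
    obtain ⟨S₀, hS₀, hS₀V⟩ := Set.not_subset.mp hsub
    obtain ⟨φ, hφ, hφV⟩ := Submodule.exists_le_ker_of_notMem hS₀V
    have hS₀U : S₀ ∈ U := hU ▸ Submodule.subset_span hS₀
    refine ⟨φ.domRestrict U, fun h0 => hφ ?_, fun i S hi => ?_⟩
    · have := LinearMap.congr_fun h0 ⟨S₀, hS₀U⟩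
      simpa using this
    · have := hw (φ.domRestrict U) ⟨S, hinr i S hi⟩
      simp only [LinearMap.domRestrict_apply] at this
      rw [this]
      exact hφV (Submodule.subset_span ⟨i, hi⟩)

-- Union bound over the two failures in `exists_of_decode_ne`: `exp(-3) ≤ 1/6` for functionals and
-- `1/8` for wrong hypotheses.
open scoped Classical in
theorem sum_decode_ne_le {c : BoolFun n} {k : ℕ} (hk : 0 < k) (hc : c ∈ sparseClass n k) {T : ℕ}
    (hT : 384 * Real.log (16 * k) * k * (Module.finrank (ZMod 2)
      (Submodule.span (ZMod 2) (fourierSupport c.toReal)) + 1) ≤ T) :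
    ∑ s : Fin T → ExampleBasis n ⊕ ExampleBasis n,
      (if decode k s ≠ c then ∏ i, sampleProb c (s i) else 0) ≤ 1 / 3 := by
  set U := Submodule.span (ZMod 2) (fourierSupport c.toReal) with hU
  set r := Module.finrank (ZMod 2) U with hr
  have hcU : fourierSupport c.toReal ⊆ U := Submodule.subset_span
  have hk1 : (1 : ℝ) ≤ k := by exact_mod_cast hk
  choose w hw using exists_dotProduct_eq U
  have : Fintype (Module.Dual (ZMod 2) U) :=
    have : Finite (Module.Dual (ZMod 2) U) := Module.finite_of_finite (ZMod 2)
    Fintype.ofFinite _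
  set D : Finset (Module.Dual (ZMod 2) U) := {v | v ≠ 0} with hD
  set B : Finset (BoolFun n) :=
    {c' | c' ∈ sparseClass n k ∧ c' ≠ c ∧ fourierSupport c'.toReal ⊆ U} with hB
  set P : (Fin T → ExampleBasis n ⊕ ExampleBasis n) → ℝ := fun s => ∏ i, sampleProb c (s i) with hP
  have hPnn : ∀ s, 0 ≤ P s := fun s => prod_nonneg fun i _ => sampleProb_nonneg c _
  have hunion : ∑ s, (if decode k s ≠ c then P s else 0)
      ≤ ∑ v ∈ D, ∑ s, (if ∀ i, ∀ S, s i = .inr (S, -1) → S ⬝ᵥ w v = 0 then P s else 0)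
        + ∑ c' ∈ B, ∑ s, (if ∀ i, ∀ x b, s i = .inl (x, b) → b = c' x then P s else 0) := by
    rw [sum_comm (s := D), sum_comm (s := B), ← sum_add_distrib]
    refine sum_le_sum fun s _ => ?_
    have nn1 : ∀ v ∈ D,
        0 ≤ if ∀ i, ∀ S, s i = .inr (S, -1) → S ⬝ᵥ w v = 0 then P s else 0 :=
      fun v _ => by split_ifs <;> simp [hPnn]
    have nn2 : ∀ c' ∈ B,
        0 ≤ if ∀ i, ∀ x b, s i = .inl (x, b) → b = c' x then P s else 0 :=
      fun v _ => by split_ifs <;> simp [hPnn]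
    split_ifs with h
    · by_cases h0 : P s = 0
      · rw [h0]; simp
      · rcases exists_of_decode_ne hc U hU w hw h h0 with ⟨v, hv, hvs⟩ | ⟨c', hc', hcs⟩
        · have := single_le_sum nn1 (show v ∈ D by simp [hD, hv])
          rw [if_pos hvs] at this
          linarith [sum_nonneg nn2]
        · have := single_le_sum nn2 (show c' ∈ B by simpa [hB] using hc')
          rw [if_pos hcs] at this
          linarith [sum_nonneg nn1]
    · exact add_nonneg (sum_nonneg nn1) (sum_nonneg nn2)
  have hfirst : ∑ v ∈ D, ∑ s, (if ∀ i, ∀ S, s i = .inr (S, -1) → S ⬝ᵥ w v = 0 then P s else 0)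
      ≤ Real.exp (-3) := by
    have hlog : 1 ≤ Real.log (16 * k) := by
      rw [Real.le_log_iff_exp_le (by positivity)]
      linarith [Real.exp_one_lt_three]
    -- Each functional escapes detection with probability at most `exp(-T/(4k))`, and there are at
    -- most `2^r ≤ exp r` of them, leaving `exp(-3)`.
    have hT' : (r : ℝ) + 3 ≤ T / (4 * k) := by
      rw [le_div_iff₀ (by positivity)]
      refine le_trans ?_ hT
      have h1 : 384 * 1 * k * ((r : ℝ) + 1) ≤ 384 * Real.log (16 * k) * k * (r + 1) := by gcongr
      have h2 : 0 ≤ (k : ℝ) * r := by positivity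
      nlinarith
    have heach : ∀ v ∈ D, ∑ s, (if ∀ i, ∀ S, s i = .inr (S, -1) → S ⬝ᵥ w v = 0 then P s else 0)
        ≤ Real.exp (-(r + 3)) := by
      intro v hv
      have h := sum_prod_ite_forall (sampleProb c)
        (fun o => ∀ S, o = .inr (S, -1) → S ⬝ᵥ w v = 0) T
      rw [h]
      -- A functional vanishing on the Fourier support would vanish on its span `U`.
      have hne : ∃ S, cubeFourierCoeff c.toReal S ≠ 0 ∧ S ⬝ᵥ w v ≠ 0 := by
        by_contra! hcon
        have hv0 : v ≠ 0 := by simpa [hD] using hv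
        apply hv0
        have : U ≤ LinearMap.ker ((Matrix.vecMulLinear (Matrix.of fun i (_ : Unit) => w v i))) := by
          rw [hU, Submodule.span_le]
          intro S hS
          ext
          simpa [Matrix.vecMul] using hcon S hS
        ext S
        have hS := congrFun (this S.2) ()
        rw [← hw v S]
        simpa [Matrix.vecMul] using hS
      have hp := sum_sampleProb_le_of_fourier hk hc (w v) hne
      refine (pow_le_pow_left₀ (sum_nonneg fun o _ => ?_)
        (hp.trans (Real.one_sub_le_exp_neg _)) T).trans ?_
      · split_ifs
        · exact sampleProb_nonneg c o
        · exact le_rfl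
      · rw [← Real.exp_nat_mul, Real.exp_le_exp]
        rw [mul_neg, mul_one_div, neg_le_neg_iff]
        exact hT'
    refine (sum_le_sum heach).trans ?_
    have hcard : (#D : ℝ) ≤ 2 ^ r := by
      have h1 : #D ≤ Fintype.card (Module.Dual (ZMod 2) U) := card_le_univ _
      rw [Module.card_eq_pow_finrank (K := ZMod 2) (V := Module.Dual (ZMod 2) U), ZMod.card,
        Subspace.dual_finrank_eq] at h1
      exact_mod_cast h1
    have h2 : (2 : ℝ) ^ r ≤ Real.exp r := by
      have : (2 : ℝ) ≤ Real.exp 1 := by linarith [Real.add_one_le_exp 1]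
      rw [← mul_one (r : ℝ), Real.exp_nat_mul]
      gcongr
    rw [sum_const, nsmul_eq_mul]
    calc (#D : ℝ) * Real.exp (-(r + 3)) ≤ Real.exp r * Real.exp (-(r + 3)) := by
          gcongr; exact hcard.trans h2
      _ = Real.exp (-3) := by rw [← Real.exp_add]; ring_nf
  have hsecond : ∑ c' ∈ B, ∑ s, (if ∀ i, ∀ x b, s i = .inl (x, b) → b = c' x then P s else 0)
      ≤ 1 / 8 := by
    refine le_trans (le_of_eq ?_) (sum_survival_le hk hc U hcU B (by simp [hB]) hT)
    refine sum_congr rfl fun c' _ => ?_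
    rw [← sum_sampleProb_of_consistent]
    exact sum_prod_ite_forall (sampleProb c) (fun o => ∀ x b, o = .inl (x, b) → b = c' x) T
  have hexp : Real.exp (-3) ≤ 1 / 6 := by
    rw [Real.exp_neg, ← one_div]
    refine one_div_le_one_div_of_le (by norm_num) ?_
    have h3 : Real.exp 3 = Real.exp 1 ^ 3 := by rw [← Real.exp_nat_mul]; norm_num
    rw [h3]
    have : (2 : ℝ) ≤ Real.exp 1 := by linarith [Real.add_one_le_exp 1]
    calc (6 : ℝ) ≤ 2 ^ 3 := by norm_num
      _ ≤ _ := by gcongr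
  linarith

/-- Sampling in a random one of the two bases and decoding learns the sparse functions. -/
theorem exactlyLearns_sparseClass {k T : ℕ} (hk : 0 < k)
    (hT : 384 * Real.log (16 * k) * k * (16 * √k * Real.log k + √(2 * k) + 1) ≤ T) :
    QuantumLearner.ExactlyLearns (T := T) (productPOVM sampleVecC sum_sampleVecC_mul (decode k))
      (sparseClass n k) (2 / 3) := by
  intro c hc
  rw [productPOVM_prob]
  have hk1 : (1 : ℝ) ≤ k := by exact_mod_cast hk
  have hlog : 0 ≤ Real.log (16 * k) := Real.log_nonneg (by linarith)
  have hr := c.finrank_span_fourierSupport_le hc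
  have herr := sum_decode_ne_le hk hc (T := T) (by
    refine le_trans ?_ hT
    gcongr)
  have htot : ∑ s : Fin T → ExampleBasis n ⊕ ExampleBasis n, ∏ i, sampleProb c (s i) = 1 := by
    rw [← Fintype.sum_pow, sum_sampleProb, one_pow]
  rw [← sum_filter] at herr
  rw [← sum_filter_add_sum_filter_not _ (fun s => decode k s = c)] at htot
  simp only [ne_eq] at herr
  have h : 2 / 3 ≤ ∑ s : Fin T → ExampleBasis n ⊕ ExampleBasis n with decode k s = c,
      ∏ i, sampleProb c (s i) := by
    linarith
  convert h
  rfl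

/-- With `L = log₂ k ≥ 1`, the logarithm is at most `5 L` and the bracket at most `19 √k L`; `384 *
5 * 19 = 36480`, and `40000` leaves room for the ceiling. -/
lemma sample_count_le {k : ℕ} (hk : 2 ≤ k) :
    (⌈384 * Real.log (16 * k) * k * (16 * √k * Real.log k + √(2 * k) + 1)⌉₊ : ℝ)
      ≤ 40000 * ((k : ℝ) ^ (3 / 2 : ℝ) * (Real.logb 2 k) ^ 2) := by
  have hk2 : (2 : ℝ) ≤ k := by exact_mod_cast hk
  have hk0 : (0 : ℝ) < k := by linarith
  set L := Real.logb 2 k with hL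
  have hln2 : Real.log 2 ≤ 1 := by linarith [Real.log_two_lt_d9]
  have hln2pos : 0 < Real.log 2 := Real.log_pos (by norm_num)
  have hL1 : 1 ≤ L := by
    rw [hL, Real.le_logb_iff_rpow_le (by norm_num) hk0, Real.rpow_one]; exact hk2
  have hlogk : Real.log k ≤ L := by
    have h : Real.log k = L * Real.log 2 := by
      rw [hL, Real.logb, div_mul_cancel₀ _ hln2pos.ne']
    rw [h]
    nlinarith
  have hlogk0 : 0 ≤ Real.log k := Real.log_nonneg (by linarith)
  have hlog16 : Real.log (16 * k) ≤ 5 * L := by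
    rw [Real.log_mul (by norm_num) hk0.ne']
    have : Real.log 16 = 4 * Real.log 2 := by
      rw [show (16 : ℝ) = 2 ^ 4 by norm_num, Real.log_pow]; norm_num
    linarith
  have hlog0 : 0 ≤ Real.log (16 * k) := Real.log_nonneg (by linarith)
  have hs1 : 1 ≤ √(k : ℝ) := Real.one_le_sqrt.mpr (by linarith)
  have hs2 : √(2 * k : ℝ) ≤ 2 * √k := by
    rw [Real.sqrt_mul (by norm_num)]
    have : √(2 : ℝ) ≤ 2 := Real.sqrt_le_iff.mpr ⟨by norm_num, by norm_num⟩
    gcongr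
  have hpow : (k : ℝ) ^ (3 / 2 : ℝ) = k * √k := by
    rw [show (3 / 2 : ℝ) = 1 + 1 / 2 by norm_num, Real.rpow_add hk0, Real.rpow_one,
      Real.sqrt_eq_rpow]
  have hbr : 16 * √k * Real.log k + √(2 * k) + 1 ≤ 19 * (√k * L) := by
    have h1 : 16 * √k * Real.log k ≤ 16 * √(k : ℝ) * L := by gcongr
    have h2 : √(k : ℝ) ≤ √k * L := le_mul_of_one_le_right (by positivity) hL1
    linarith
  have hmain : 384 * Real.log (16 * k) * k * (16 * √k * Real.log k + √(2 * k) + 1)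
      ≤ 36480 * (k * √k * L ^ 2) := by
    calc _ ≤ 384 * (5 * L) * k * (19 * (√k * L)) := by gcongr
      _ = _ := by ring
  have hone : 1 ≤ k * √k * L ^ 2 :=
    one_le_mul_of_one_le_of_one_le (one_le_mul_of_one_le_of_one_le (by linarith) hs1)
      (one_le_pow₀ hL1)
  have hceil := Nat.ceil_lt_add_one
    (a := 384 * Real.log (16 * k) * k * (16 * √k * Real.log k + √(2 * k) + 1)) (by positivity)
  rw [hpow]
  linarith

end

end QLearn

theorem mainTheorem1 :
    ∃ K : ℝ, 0 < K ∧ ∀ n k : ℕ, 0 < n → 2 ≤ k → k ≤ 2 ^ n →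
      ∃ T : ℕ, (T : ℝ) ≤ K * ((k : ℝ) ^ (3 / 2 : ℝ) * (Real.logb 2 k) ^ 2) ∧
        ∃ L : QLearn.QuantumLearner n T,
          QLearn.QuantumLearner.ExactlyLearns L (QLearn.sparseClass n k) (2 / 3) := by
  refine ⟨40000, by norm_num, fun n k _ hk _ => ⟨_, QLearn.sample_count_le hk, _,
    QLearn.exactlyLearns_sparseClass (by omega) (Nat.le_ceil _)⟩⟩
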